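/- **Setting.** All functions are complex-valued unless said otherwise. For functions on $[0,1]$ put $Df(\rho)=\frac1\rho f'(\rho)$ and $Kf(\rho)=\int_0^\rho s f(s)\,ds$. Let $$\tilde{\mathcal H}=\{(u_1,u_2)\in C^4[0,1]\times C^1[0,1] : u_1^{(k)}(0)=u_2(0)=0,\ k=0,1,2,3\},$$ $$(\mathbf u|\mathbf v)=\int_0^1 D^2u_1\,\overline{D^2v_1}\,d\rho+\int_0^1 u_2'\,\overline{v_2'}\,d\rho ,$$ and let $\mathcal H$ be the Hilbert space obtained by completing $\tilde{\mathcal H}$ with respect to this inner product. Let $\mathcal D(\tilde{\mathbf L}_0)$ be the set of $\mathbf u=(u_1,u_2)\in C^\infty[0,1]\times C^\infty[0,1]$ with $u_1^{(k)}(0)=u_2(0)=0$ for $k=0,\dots,4$, define $$\tilde{\mathbf L}_0\mathbf u(\rho)=\begin{pmatrix}-\rho u_1'(\rho)+2u_1(\rho)+\rho^2u_2(\rho)-3Ku_2(\rho)\\ D^2u_1(\rho)-\rho u_2'(\rho)-u_2(\rho)\end{pmatrix},\qquad \mathbf u\in\mathcal D(\tilde{\mathbf L}_0),$$ and let $\mathbf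 L_0$ be the closure of $\tilde{\mathbf L}_0$ in $\mathcal H$. For a real-valued $V\in C^\infty[0,1]$ let $\mathbf L'_V\in\mathcal B(\mathcal H)$ be the continuous extension to $\mathcal H$ of $\mathbf u\mapsto(-V K^2u_2,\,0)$, $\mathbf u\in\mathcal D(\tilde{\mathbf L}_0)$, and put $\mathbf L_V=\mathbf L_0+\mathbf L'_V$ with domain $\mathcal D(\mathbf L_0)$. The linearized generator is $\mathbf L=\mathbf L_V$ for the Yang–Mills potential $$V(\rho)=-144\,\frac{5-\rho^2}{(5+3\rho^2)^2}=\frac{3F'(W_0(\rho)-1)-6}{\rho^2},\qquad F(\psi)=\psi(\psi+1)(\psi+2),\quad W_0(\rho)=\frac{1-\rho^2}{1+\frac35\rho^2}.$$ **Lemma 3.9.** For every $\varepsilon>0$ there exist constants $C_1,C_2>0$ such that every $\lambda\in\mathbb C$ with $\operatorname{Re}\lambda\ge-\frac32+\varepsilon$ and $|\lambda|\ge C_1$ belongs to the resolvent set of $\mathbf L$, and the resolvent $\mathbf R_{\mathbf L}(\lambda)=(\lambda-\mathbf L)^{-1}$ satisfies $$\|\mathbf R_{\mathbf L}(\lambda)\|\le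 C_2 .$$ In particular, $\mathbf L$ has no unstable eigenvalues far away from the real axis: there is a $C>0$ such that no $\lambda\in\mathbb C$ with $\operatorname{Re}\lambda\ge0$ and $|\operatorname{Im}\lambda|\ge C$ is an eigenvalue of $\mathbf L$. The statement does not depend on the special form of the potential: for every real-valued $V\in C^\infty[0,1]$ both assertions hold with $\mathbf L_V$ in place of $\mathbf L$ (with constants $C_1,C_2$ depending on $\varepsilon$ and $V$, and $C$ depending on $V$). -/

import Mathlib

open scoped ContDiff

namespace YangMills

open Set MeasureTheory
open scoped ComplexConjugate

noncomputable section

/-! ### The unit interval and the operators `D`, `K` -/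

/-- The closed unit interval `[0,1]`. -/
abbrev I01 : Set ℝ := Icc (0 : ℝ) 1

/-- A function on `[0,1]`, regarded as a function on `ℝ` (constant to the left of `0` and to the
right of `1`). Only its values on `[0,1]` are ever used: smoothness is `ContDiffOn ℝ n _ I01` and
derivatives are taken within `[0,1]`, i.e. one-sided at the endpoints. -/
def ext (f : I01 → ℂ) : ℝ → ℂ := IccExtend zero_le_one f

/-- `D f (ρ) = f'(ρ) / ρ`, with the derivative taken within `[0,1]`. -/
def D (f : ℝ → ℂ) (ρ : ℝ) : ℂ := derivWithin f I01 ρ / (ρ : ℂ)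

/-- `K f (ρ) = ∫₀^ρ s f(s) ds`. -/
def K (f : ℝ → ℂ) (ρ : ℝ) : ℂ := ∫ s in (0 : ℝ)..ρ, (s : ℂ) * f s

/-! ### Elementary facts needed for the definitions -/

lemma zero_mem : (0 : ℝ) ∈ I01 := ⟨le_rfl, zero_le_one⟩

lemma uniq : UniqueDiffOn ℝ I01 := uniqueDiffOn_Icc_zero_one

lemma ext_add (f g : I01 → ℂ) : ext (f + g) = ext f + ext g := rfl

lemma ext_smul (c : ℂ) (f : I01 → ℂ) : ext (c • f) = c • ext f := rfl

lemma ext_zero : ext 0 = 0 := rfl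

lemma ext_restrict (f : ℝ → ℂ) : EqOn (ext fun ρ : I01 => f ρ) f I01 := by
  intro x hx
  simp only [ext]
  rw [IccExtend_of_mem _ _ hx]

lemma taylor_lead {f : ℝ → ℂ} {n : ℕ} (hf : ContDiffOn ℝ (n + 1) f I01)
    (h : ∀ k < n, iteratedDerivWithin k f I01 0 = 0) :
    ∃ C, 0 ≤ C ∧ ∀ x ∈ I01,
      ‖f x - ((n.factorial : ℝ)⁻¹ * x ^ n) • iteratedDerivWithin n f I01 0‖ ≤ C * x ^ (n + 1) := by
  obtain ⟨C, hC⟩ := exists_taylor_mean_remainder_bound zero_le_one hf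
  refine ⟨|C|, abs_nonneg _, fun x hx => ?_⟩
  have := hC x hx
  rw [taylor_within_apply, Finset.sum_range_succ, Finset.sum_eq_zero, zero_add] at this
  · simp only [sub_zero] at this
    exact this.trans (mul_le_mul_of_nonneg_right (le_abs_self C) (pow_nonneg hx.1 _))
  · intro k hk
    rw [h k (Finset.mem_range.1 hk), smul_zero]

lemma taylor_zero {f : ℝ → ℂ} {n : ℕ} (hf : ContDiffOn ℝ (n + 1) f I01)
    (h : ∀ k ≤ n, iteratedDerivWithin k f I01 0 = 0) :
    ∃ C, 0 ≤ C ∧ ∀ x ∈ I01, ‖f x‖ ≤ C * x ^ (n + 1) := by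
  obtain ⟨C, h0, hC⟩ := taylor_lead hf fun k hk => h k hk.le
  refine ⟨C, h0, fun x hx => ?_⟩
  simpa [h n le_rfl] using hC x hx

lemma vanish_of_bound {f : ℝ → ℂ} {n : ℕ} (hf : ContDiffOn ℝ ∞ f I01) {C : ℝ}
    (hC : ∀ x ∈ I01, ‖f x‖ ≤ C * x ^ (n + 1)) :
    ∀ k ≤ n, iteratedDerivWithin k f I01 0 = 0 := by
  intro k
  induction k using Nat.strong_induction_on with
  | _ k ih =>
    intro hk
    obtain ⟨C', hC'0, hC'⟩ := taylor_lead (f := f) (n := k)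
      (hf.of_le (by exact_mod_cast le_top)) fun j hj => ih j hj (by omega)
    set a := iteratedDerivWithin k f I01 0
    have hfac : (0 : ℝ) < (k.factorial : ℝ) := by exact_mod_cast k.factorial_pos
    have key : ∀ x ∈ Ioc (0 : ℝ) 1, ‖a‖ ≤ ((|C| + C') * k.factorial) * x := by
      intro x hx
      have hx' : x ∈ I01 := ⟨hx.1.le, hx.2⟩
      have h1 := hC x hx'
      have h2 := hC' x hx'
      have h3 : ‖((k.factorial : ℝ)⁻¹ * x ^ k) • a‖ ≤ C * x ^ (n + 1) + C' * x ^ (k + 1) := by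
        calc _ = ‖f x - (f x - ((k.factorial : ℝ)⁻¹ * x ^ k) • a)‖ := by rw [sub_sub_cancel]
          _ ≤ _ := (norm_sub_le _ _).trans (add_le_add h1 h2)
      have h4 : C * x ^ (n + 1) ≤ |C| * x ^ (k + 1) :=
        (mul_le_mul_of_nonneg_right (le_abs_self C) (pow_nonneg hx'.1 _)).trans
          (mul_le_mul_of_nonneg_left (pow_le_pow_of_le_one hx'.1 hx.2 (by omega)) (abs_nonneg _))
      rw [norm_smul, Real.norm_of_nonneg (by have := hx.1; positivity)] at h3
      have hxk : 0 < x ^ k := pow_pos hx.1 k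
      have h5 : ((k.factorial : ℝ)⁻¹ * x ^ k) * ‖a‖
          ≤ ((k.factorial : ℝ)⁻¹ * x ^ k) * (((|C| + C') * k.factorial) * x) := by
        calc _ ≤ |C| * x ^ (k + 1) + C' * x ^ (k + 1) := by linarith
          _ = _ := by field_simp; ring
      exact le_of_mul_le_mul_left h5 (by positivity)
    by_contra ha
    have hpos : 0 < ‖a‖ := norm_pos_iff.2 ha
    set M := (|C| + C') * (k.factorial : ℝ)
    have hM : 0 ≤ M := by positivity
    have hx : min 1 (‖a‖ / (2 * (M + 1))) ∈ Ioc (0 : ℝ) 1 :=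
      ⟨lt_min one_pos (by positivity), min_le_left _ _⟩
    have h1 := key _ hx
    have h2 : M * min 1 (‖a‖ / (2 * (M + 1))) ≤ M * (‖a‖ / (2 * (M + 1))) :=
      mul_le_mul_of_nonneg_left (min_le_right _ _) hM
    have h3 : M * (‖a‖ / (2 * (M + 1))) < ‖a‖ := by
      rw [mul_div_assoc', div_lt_iff₀ (by positivity)]
      nlinarith
    linarith

lemma iDW_zero (f : ℝ → ℂ) : iteratedDerivWithin 0 f I01 0 = f 0 := by simp

lemma iDW_deriv (f : ℝ → ℂ) (k : ℕ) :
    iteratedDerivWithin k (derivWithin f I01) I01 0 = iteratedDerivWithin (k + 1) f I01 0 := by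
  rw [iteratedDerivWithin_succ']

lemma smooth_deriv {f : ℝ → ℂ} (hf : ContDiffOn ℝ ∞ f I01) :
    ContDiffOn ℝ ∞ (derivWithin f I01) I01 :=
  ((contDiffOn_infty_iff_derivWithin uniq).1 hf).2

lemma smooth_le {f : ℝ → ℂ} (hf : ContDiffOn ℝ ∞ f I01) (n : ℕ) : ContDiffOn ℝ n f I01 :=
  hf.of_le (by exact_mod_cast le_top)

lemma smooth_id : ContDiffOn ℝ ∞ (fun ρ : ℝ => (ρ : ℂ)) I01 :=
  Complex.ofRealCLM.contDiff.contDiffOn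

lemma K_hasDeriv {f : ℝ → ℂ} (hf : ContinuousOn f I01) {ρ : ℝ} (hρ : ρ ∈ I01) :
    HasDerivWithinAt (K f) ((ρ : ℂ) * f ρ) I01 ρ := by
  have hc : ContinuousOn (fun s : ℝ => (s : ℂ) * f s) I01 :=
    (Complex.continuous_ofReal.continuousOn).mul hf
  have : Fact (ρ ∈ Icc (0 : ℝ) 1) := ⟨hρ⟩
  refine intervalIntegral.integral_hasDerivWithinAt_right (t := I01) ?_ ?_ (hc ρ hρ)
  · apply ContinuousOn.intervalIntegrable
    rw [uIcc_of_le hρ.1]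
    exact hc.mono (Icc_subset_Icc_right hρ.2)
  · exact hc.stronglyMeasurableAtFilter_nhdsWithin measurableSet_Icc ρ

lemma K_derivWithin {f : ℝ → ℂ} (hf : ContinuousOn f I01) :
    EqOn (derivWithin (K f) I01) (fun ρ => (ρ : ℂ) * f ρ) I01 :=
  fun ρ hρ => (K_hasDeriv hf hρ).derivWithin (uniq ρ hρ)

lemma K_smooth {f : ℝ → ℂ} (hf : ContDiffOn ℝ ∞ f I01) : ContDiffOn ℝ ∞ (K f) I01 := by
  rw [contDiffOn_infty_iff_derivWithin uniq]
  exact ⟨fun ρ hρ => (K_hasDeriv hf.continuousOn hρ).differentiableWithinAt,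
    (smooth_id.mul hf).congr (K_derivWithin hf.continuousOn)⟩

lemma K_bound {f : ℝ → ℂ} {n : ℕ} {C : ℝ} (hC0 : 0 ≤ C) (hC : ∀ x ∈ I01, ‖f x‖ ≤ C * x ^ n) :
    ∀ x ∈ I01, ‖K f x‖ ≤ C * x ^ (n + 2) := by
  intro x hx
  have := intervalIntegral.norm_integral_le_of_norm_le_const (a := 0) (b := x)
    (f := fun s : ℝ => (s : ℂ) * f s) (C := C * x ^ (n + 1)) ?_
  · rw [sub_zero, abs_of_nonneg hx.1] at this
    exact this.trans_eq (by ring)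
  · intro s hs
    rw [uIoc_of_le hx.1] at hs
    rw [norm_mul, Complex.norm_of_nonneg hs.1.le]
    have h1 := hC s ⟨hs.1.le, hs.2.trans hx.2⟩
    calc s * ‖f s‖ ≤ x * (C * x ^ n) := by
          apply mul_le_mul hs.2 (h1.trans _) (norm_nonneg _) hx.1
          exact mul_le_mul_of_nonneg_left (pow_le_pow_left₀ hs.1.le hs.2 n) hC0
      _ = _ := by ring

lemma K_congr {f g : ℝ → ℂ} (h : EqOn f g I01) : EqOn (K f) (K g) I01 := by
  intro x hx
  refine intervalIntegral.integral_congr fun s hs => ?_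
  rw [uIcc_of_le hx.1] at hs
  simp only [h ⟨hs.1, hs.2.trans hx.2⟩]

lemma K_add {f g : ℝ → ℂ} (hf : ContinuousOn f I01) (hg : ContinuousOn g I01) :
    EqOn (K (f + g)) (K f + K g) I01 := by
  intro x hx
  have h : ∀ {f : ℝ → ℂ}, ContinuousOn f I01 →
      IntervalIntegrable (fun s : ℝ => (s : ℂ) * f s) volume 0 x := by
    intro f hf
    apply ContinuousOn.intervalIntegrable
    rw [uIcc_of_le hx.1]
    exact ((Complex.continuous_ofReal.continuousOn).mul hf).mono (Icc_subset_Icc_right hx.2)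
  simp only [K, Pi.add_apply, mul_add]
  exact intervalIntegral.integral_add (h hf) (h hg)

lemma K_smul (c : ℂ) (f : ℝ → ℂ) : K (c • f) = c • K f := by
  ext x
  simp only [K, Pi.smul_apply, smul_eq_mul, ← intervalIntegral.integral_const_mul]
  congr 1; ext s; ring

/-- `D² f = f''/ρ² - f'/ρ³`; both sides are `0` at `ρ = 0` by the convention `x / 0 = 0`. -/
lemma DD_eq {f : ℝ → ℂ} (hf : ContDiffOn ℝ 2 f I01) {ρ : ℝ} (hρ : ρ ∈ I01) :
    D (D f) ρ = derivWithin (derivWithin f I01) I01 ρ / (ρ : ℂ) ^ 2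
      - derivWithin f I01 ρ / (ρ : ℂ) ^ 3 := by
  rcases eq_or_lt_of_le hρ.1 with h0 | h0
  · simp [D, ← h0]
  have hne : (ρ : ℂ) ≠ 0 := by exact_mod_cast h0.ne'
  have h1 : ContDiffOn ℝ 1 (derivWithin f I01) I01 := hf.derivWithin uniq (by norm_num)
  have h2 : HasDerivWithinAt (derivWithin f I01) (derivWithin (derivWithin f I01) I01 ρ) I01 ρ :=
    ((h1.differentiableOn (by norm_num)) ρ hρ).hasDerivWithinAt
  have h3 : HasDerivWithinAt (fun ρ : ℝ => (ρ : ℂ)) 1 I01 ρ :=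
    (Complex.ofRealCLM.hasDerivAt (x := ρ)).hasDerivWithinAt
  have h4 := (h2.div h3 hne).derivWithin (uniq ρ hρ)
  have h5 : D f = derivWithin f I01 / fun ρ : ℝ => (ρ : ℂ) := rfl
  rw [D, h5, h4]
  field_simp

lemma DD_continuousOn {f : ℝ → ℂ} (hf : ContDiffOn ℝ 2 f I01) :
    ContinuousOn (D (D f)) (Ioc 0 1) := by
  have h1 : ContDiffOn ℝ 1 (derivWithin f I01) I01 := hf.derivWithin uniq (by norm_num)
  have h2 : ContDiffOn ℝ 0 (derivWithin (derivWithin f I01) I01) I01 :=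
    h1.derivWithin uniq (by norm_num)
  have hs : Ioc (0 : ℝ) 1 ⊆ I01 := Ioc_subset_Icc_self
  have hid : ContinuousOn (fun ρ : ℝ => (ρ : ℂ)) (Ioc 0 1) :=
    Complex.continuous_ofReal.continuousOn
  have hne : ∀ ρ ∈ Ioc (0 : ℝ) 1, (ρ : ℂ) ≠ 0 := fun ρ hρ => by exact_mod_cast hρ.1.ne'
  refine ContinuousOn.congr (f := fun ρ : ℝ => derivWithin (derivWithin f I01) I01 ρ / (ρ : ℂ) ^ 2
      - derivWithin f I01 ρ / (ρ : ℂ) ^ 3) ?_ fun ρ hρ => DD_eq hf (hs hρ)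
  exact ((h2.continuousOn.mono hs).div (hid.pow 2) fun ρ hρ => pow_ne_zero _ (hne ρ hρ)).sub
    ((h1.continuousOn.mono hs).div (hid.pow 3) fun ρ hρ => pow_ne_zero _ (hne ρ hρ))

lemma DD_bound {f : ℝ → ℂ} (hf : ContDiffOn ℝ 4 f I01)
    (h : ∀ k ≤ 3, iteratedDerivWithin k f I01 0 = 0) : ∃ C, ∀ ρ ∈ I01, ‖D (D f) ρ‖ ≤ C := by
  have h1 : ContDiffOn ℝ 3 (derivWithin f I01) I01 := hf.derivWithin uniq (by norm_num)
  have h2 : ContDiffOn ℝ 2 (derivWithin (derivWithin f I01) I01) I01 :=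
    h1.derivWithin uniq (by norm_num)
  obtain ⟨C1, p1, b1⟩ := taylor_zero (n := 2) (by norm_num; exact h1)
    fun k hk => by rw [iDW_deriv]; exact h _ (by omega)
  obtain ⟨C2, p2, b2⟩ := taylor_zero (n := 1) (by norm_num; exact h2)
    fun k hk => by rw [iDW_deriv, iDW_deriv]; exact h _ (by omega)
  refine ⟨C2 + C1, fun ρ hρ => ?_⟩
  rcases eq_or_lt_of_le hρ.1 with h0 | h0
  · simp [D, ← h0]; positivity
  rw [DD_eq (hf.of_le (by norm_num)) hρ]
  refine (norm_sub_le _ _).trans (add_le_add ?_ ?_)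
  · rw [norm_div, norm_pow, Complex.norm_of_nonneg hρ.1, div_le_iff₀ (by positivity)]
    exact b2 ρ hρ
  · rw [norm_div, norm_pow, Complex.norm_of_nonneg hρ.1, div_le_iff₀ (by positivity)]
    exact b1 ρ hρ

/-- The second component of the free operator produces `C¹` functions on `[0,1]`. -/
lemma DD_contDiffOn {f : ℝ → ℂ} (hf : ContDiffOn ℝ ∞ f I01)
    (h : ∀ k ≤ 4, iteratedDerivWithin k f I01 0 = 0) : ContDiffOn ℝ 1 (D (D f)) I01 := by
  set f1 := derivWithin f I01 with hf1
  set f2 := derivWithin f1 I01 with hf2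
  set f3 := derivWithin f2 I01 with hf3
  have s1 : ContDiffOn ℝ ∞ f1 I01 := smooth_deriv hf
  have s2 : ContDiffOn ℝ ∞ f2 I01 := smooth_deriv s1
  have s3 : ContDiffOn ℝ ∞ f3 I01 := smooth_deriv s2
  set a : ℂ := iteratedDerivWithin 5 f I01 0
  have e1 : ∀ k, iteratedDerivWithin k f1 I01 0 = iteratedDerivWithin (k + 1) f I01 0 :=
    iDW_deriv f
  have e2 : ∀ k, iteratedDerivWithin k f2 I01 0 = iteratedDerivWithin (k + 2) f I01 0 :=
    fun k => by rw [hf2, iDW_deriv, e1]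
  have e3 : ∀ k, iteratedDerivWithin k f3 I01 0 = iteratedDerivWithin (k + 3) f I01 0 :=
    fun k => by rw [hf3, iDW_deriv, e2]
  obtain ⟨C1, p1, b1⟩ := taylor_lead (n := 4) (f := f1) (mod_cast smooth_le s1 5)
    fun k hk => by rw [e1]; exact h _ (by omega)
  obtain ⟨C2, p2, b2⟩ := taylor_lead (n := 3) (f := f2) (mod_cast smooth_le s2 4)
    fun k hk => by rw [e2]; exact h _ (by omega)
  obtain ⟨C3, p3, b3⟩ := taylor_lead (n := 2) (f := f3) (mod_cast smooth_le s3 3)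
    fun k hk => by rw [e3]; exact h _ (by omega)
  rw [e1] at b1; rw [e2] at b2; rw [e3] at b3
  norm_num [Nat.factorial] at b1 b2 b3
  change ∀ x : ℝ, 0 ≤ x → x ≤ 1 → ‖f1 x - 1 / 24 * (x : ℂ) ^ 4 * a‖ ≤ C1 * x ^ 5 at b1
  change ∀ x : ℝ, 0 ≤ x → x ≤ 1 → ‖f2 x - 1 / 6 * (x : ℂ) ^ 3 * a‖ ≤ C2 * x ^ 4 at b2
  change ∀ x : ℝ, 0 ≤ x → x ≤ 1 → ‖f3 x - 1 / 2 * (x : ℂ) ^ 2 * a‖ ≤ C3 * x ^ 3 at b3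
  have hDD : ∀ ρ ∈ I01, D (D f) ρ = f2 ρ / (ρ : ℂ) ^ 2 - f1 ρ / (ρ : ℂ) ^ 3 := fun ρ hρ =>
    DD_eq (mod_cast smooth_le hf 2) hρ
  let G : ℝ → ℂ := fun ρ => if ρ = 0 then a / 8 else
    f3 ρ / (ρ : ℂ) ^ 2 - 3 * f2 ρ / (ρ : ℂ) ^ 3 + 3 * f1 ρ / (ρ : ℂ) ^ 4
  have nb : ∀ (z : ℂ) (ρ C : ℝ) (m n : ℕ), 0 < ρ → ‖z‖ ≤ C * ρ ^ (m + n) →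
      ‖z / (ρ : ℂ) ^ n‖ ≤ C * ρ ^ m := by
    intro z ρ C m n h0 hz
    rw [norm_div, norm_pow, Complex.norm_of_nonneg h0.le, div_le_iff₀ (by positivity), mul_assoc,
      ← pow_add]
    exact hz
  have hasD : ∀ ρ ∈ I01, HasDerivWithinAt (D (D f)) (G ρ) I01 ρ := by
    intro ρ hρ
    rcases eq_or_lt_of_le hρ.1 with h0 | h0
    · subst h0
      simp only [G, if_true]
      rw [hasDerivWithinAt_iff_isLittleO]
      have hD0 : D (D f) 0 = 0 := by simp [D]
      have hO : (fun x' : ℝ => D (D f) x' - D (D f) 0 - (x' - 0) • (a / 8)) =O[nhdsWithin 0 I01]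
          fun x' : ℝ => x' ^ 2 := by
        refine Asymptotics.IsBigO.of_bound (C2 + C1) ?_
        filter_upwards [self_mem_nhdsWithin] with x hx
        rw [hD0, Real.norm_of_nonneg (by positivity)]
        rcases eq_or_lt_of_le hx.1 with h0 | h0
        · simp [← h0, hD0]
        have hne : (x : ℂ) ≠ 0 := by exact_mod_cast h0.ne'
        have : D (D f) x - 0 - (x - 0) • (a / 8)
            = (f2 x - 1 / 6 * (x : ℂ) ^ 3 * a) / (x : ℂ) ^ 2
              - (f1 x - 1 / 24 * (x : ℂ) ^ 4 * a) / (x : ℂ) ^ 3 := by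
          rw [hDD x hx, sub_zero, sub_zero, Complex.real_smul]
          field_simp
          ring
        rw [this, add_mul]
        exact (norm_sub_le _ _).trans (add_le_add (nb _ _ _ 2 2 h0 (b2 x hx.1 hx.2))
          (nb _ _ _ 2 3 h0 (b1 x hx.1 hx.2)))
      refine hO.trans_isLittleO ?_
      have := (Asymptotics.isLittleO_pow_pow (𝕜 := ℝ) (m := 1) (n := 2) (by norm_num))
      simpa using this.mono nhdsWithin_le_nhds
    · have hne : (ρ : ℂ) ≠ 0 := by exact_mod_cast h0.ne'
      have d1 : HasDerivWithinAt f1 (f2 ρ) I01 ρ :=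
        ((s1.differentiableOn (by simp)) ρ hρ).hasDerivWithinAt
      have d2 : HasDerivWithinAt f2 (f3 ρ) I01 ρ :=
        ((s2.differentiableOn (by simp)) ρ hρ).hasDerivWithinAt
      have d0 : HasDerivWithinAt (fun ρ : ℝ => (ρ : ℂ)) 1 I01 ρ :=
        (Complex.ofRealCLM.hasDerivAt (x := ρ)).hasDerivWithinAt
      have d3 := (d2.div (d0.pow 2) (pow_ne_zero 2 hne)).sub
        (d1.div (d0.pow 3) (pow_ne_zero 3 hne))
      have d4 := d3.congr_of_mem (f₁ := D (D f)) (fun x hx => hDD x hx) hρ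
      refine d4.congr_deriv ?_
      simp only [G, h0.ne', if_false, Pi.pow_apply]
      field_simp
      ring
  have hG : ContinuousOn G I01 := by
    intro ρ hρ
    rcases eq_or_lt_of_le hρ.1 with h0 | h0
    · subst h0
      have hO : (fun x : ℝ => G x - a / 8) =O[nhdsWithin 0 I01] fun x : ℝ => x := by
        refine Asymptotics.IsBigO.of_bound (C3 + 3 * C2 + 3 * C1) ?_
        filter_upwards [self_mem_nhdsWithin] with x hx
        rw [Real.norm_of_nonneg hx.1]
        rcases eq_or_lt_of_le hx.1 with h0 | h0
        · simp [← h0, G]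
        have hne : (x : ℂ) ≠ 0 := by exact_mod_cast h0.ne'
        have : G x - a / 8 = (f3 x - 1 / 2 * (x : ℂ) ^ 2 * a) / (x : ℂ) ^ 2
            - 3 * ((f2 x - 1 / 6 * (x : ℂ) ^ 3 * a) / (x : ℂ) ^ 3)
            + 3 * ((f1 x - 1 / 24 * (x : ℂ) ^ 4 * a) / (x : ℂ) ^ 4) := by
          simp only [G, h0.ne', if_false]
          field_simp
          ring
        rw [this]
        have q3 := nb _ _ _ 1 2 h0 (b3 x hx.1 hx.2)
        have q2 := nb _ _ _ 1 3 h0 (b2 x hx.1 hx.2)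
        have q1 := nb _ _ _ 1 4 h0 (b1 x hx.1 hx.2)
        refine (norm_add_le _ _).trans ?_
        refine (add_le_add (norm_sub_le _ _) le_rfl).trans ?_
        rw [norm_mul, norm_mul]
        norm_num
        norm_num at q1 q2 q3
        linarith
      have h1 : Filter.Tendsto (fun x : ℝ => G x - a / 8) (nhdsWithin 0 I01) (nhds 0) :=
        hO.trans_tendsto (Filter.tendsto_id.mono_left nhdsWithin_le_nhds)
      have h2 := h1.add_const (a / 8)
      simpa [ContinuousWithinAt, G] using h2
    · have hne : (ρ : ℂ) ≠ 0 := by exact_mod_cast h0.ne'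
      have c0 : ContinuousWithinAt (fun ρ : ℝ => (ρ : ℂ)) I01 ρ :=
        Complex.continuous_ofReal.continuousWithinAt
      have c1 := s1.continuousOn ρ hρ
      have c2 := s2.continuousOn ρ hρ
      have c3 := s3.continuousOn ρ hρ
      have c4 : ContinuousWithinAt (fun ρ : ℝ => f3 ρ / (ρ : ℂ) ^ 2 - 3 * f2 ρ / (ρ : ℂ) ^ 3
          + 3 * f1 ρ / (ρ : ℂ) ^ 4) I01 ρ :=
        ((c3.div (c0.pow 2) (pow_ne_zero _ hne)).sub
          ((continuousWithinAt_const.mul c2).div (c0.pow 3) (pow_ne_zero _ hne))).add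
          ((continuousWithinAt_const.mul c1).div (c0.pow 4) (pow_ne_zero _ hne))
      refine c4.congr_of_eventuallyEq ?_ (by simp only [G, h0.ne', if_false])
      filter_upwards [mem_nhdsWithin_of_mem_nhds (Ioi_mem_nhds h0)] with x hx
      simp only [G, (show x ≠ 0 from (ne_of_gt hx)), if_false]
  have := (contDiffOn_succ_iff_derivWithin (n := 0) (f := D (D f)) uniq).2
    ⟨fun ρ hρ => (hasD ρ hρ).differentiableWithinAt, by simp, by
      rw [contDiffOn_zero]
      exact hG.congr fun ρ hρ => (hasD ρ hρ).derivWithin (uniq ρ hρ)⟩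
  simpa using this

lemma DD_add {f g : ℝ → ℂ} (hf : ContDiffOn ℝ 2 f I01) (hg : ContDiffOn ℝ 2 g I01) :
    EqOn (D (D (f + g))) (D (D f) + D (D g)) I01 := by
  intro ρ hρ
  have k1 : ∀ {f : ℝ → ℂ}, ContDiffOn ℝ 2 f I01 → ∀ x ∈ I01, DifferentiableWithinAt ℝ f I01 x :=
    fun h => h.differentiableOn (by norm_num)
  have k2 : ∀ {f : ℝ → ℂ}, ContDiffOn ℝ 2 f I01 → ∀ x ∈ I01,
      DifferentiableWithinAt ℝ (derivWithin f I01) I01 x :=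
    fun h => (h.derivWithin uniq (m := 1) (by norm_num)).differentiableOn (by norm_num)
  have h1 : EqOn (derivWithin (f + g) I01) (derivWithin f I01 + derivWithin g I01) I01 :=
    fun x hx => derivWithin_add (k1 hf x hx) (k1 hg x hx)
  have h2 : derivWithin (derivWithin (f + g) I01) I01 ρ
      = derivWithin (derivWithin f I01) I01 ρ + derivWithin (derivWithin g I01) I01 ρ := by
    rw [derivWithin_congr h1 (h1 hρ)]
    exact derivWithin_add (k2 hf ρ hρ) (k2 hg ρ hρ)
  have h3 : D (D (f + g)) ρ = derivWithin (derivWithin (f + g) I01) I01 ρ / (ρ : ℂ) ^ 2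
      - derivWithin (f + g) I01 ρ / (ρ : ℂ) ^ 3 := DD_eq (hf.add hg) hρ
  rw [Pi.add_apply, h3, DD_eq hf hρ, DD_eq hg hρ, h2, h1 hρ, Pi.add_apply]
  ring

lemma D_smul (c : ℂ) (f : ℝ → ℂ) : D (c • f) = c • D f := by
  ext ρ
  simp only [D, Pi.smul_apply]
  rw [derivWithin_const_smul_field]
  simp [mul_div_assoc]

lemma DD_smul (c : ℂ) (f : ℝ → ℂ) : D (D (c • f)) = c • D (D f) := by
  rw [D_smul, D_smul]

/-! ### The Hilbert space -/

/-- The space `H̃` of pairs `(u₁, u₂) ∈ C⁴[0,1] × C¹[0,1]` of complex-valued functions with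
`u₁^(k)(0) = u₂(0) = 0` for `k = 0, 1, 2, 3`. -/
def preSubmodule : Submodule ℂ ((I01 → ℂ) × (I01 → ℂ)) where
  carrier := {u | ContDiffOn ℝ 4 (ext u.1) I01 ∧ ContDiffOn ℝ 1 (ext u.2) I01 ∧
    (∀ k ≤ 3, iteratedDerivWithin k (ext u.1) I01 0 = 0) ∧ ext u.2 0 = 0}
  add_mem' := by
    rintro u v ⟨hu1, hu2, hu3, hu4⟩ ⟨hv1, hv2, hv3, hv4⟩
    refine ⟨hu1.add hv1, hu2.add hv2, fun k hk => ?_, ?_⟩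
    · have hk4 : (k : ℕ∞ω) ≤ 4 := by exact_mod_cast (by omega : k ≤ 4)
      rw [Prod.fst_add, ext_add, iteratedDerivWithin_add zero_mem uniq
        ((hu1 0 zero_mem).of_le hk4) ((hv1 0 zero_mem).of_le hk4), hu3 k hk, hv3 k hk, add_zero]
    · rw [Prod.snd_add, ext_add, Pi.add_apply, hu4, hv4, add_zero]
  zero_mem' := by
    refine ⟨contDiffOn_const, contDiffOn_const, fun k _ => ?_, rfl⟩
    rw [Prod.fst_zero, ext_zero]
    simp
  smul_mem' := by
    rintro c u ⟨hu1, hu2, hu3, hu4⟩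
    refine ⟨hu1.const_smul c, hu2.const_smul c, fun k hk => ?_, ?_⟩
    · have hk4 : (k : ℕ∞ω) ≤ 4 := by exact_mod_cast (by omega : k ≤ 4)
      rw [Prod.smul_fst, ext_smul, iteratedDerivWithin_const_smul zero_mem uniq c
        ((hu1 0 zero_mem).of_le hk4), hu3 k hk, smul_zero]
    · rw [Prod.smul_snd, ext_smul, Pi.smul_apply, hu4, smul_zero]

/-- `H̃` as a type (so that it carries only the topology of its inner product). -/
def PreH : Type := preSubmodule

instance : AddCommGroup PreH := inferInstanceAs (AddCommGroup preSubmodule)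

instance : Module ℂ PreH := inferInstanceAs (Module ℂ preSubmodule)

/-- The first component `u₁`. -/
def PreH.fst (u : PreH) : ℝ → ℂ := ext u.1.1

/-- The second component `u₂`. -/
def PreH.snd (u : PreH) : ℝ → ℂ := ext u.1.2

lemma PreH.fst_contDiffOn (u : PreH) : ContDiffOn ℝ 4 u.fst I01 := u.2.1

lemma PreH.snd_contDiffOn (u : PreH) : ContDiffOn ℝ 1 u.snd I01 := u.2.2.1

lemma PreH.fst_vanish (u : PreH) : ∀ k ≤ 3, iteratedDerivWithin k u.fst I01 0 = 0 := u.2.2.2.1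

lemma PreH.snd_zero (u : PreH) : u.snd 0 = 0 := u.2.2.2.2

lemma PreH.fst_add (u v : PreH) : (u + v).fst = u.fst + v.fst := rfl

lemma PreH.snd_add (u v : PreH) : (u + v).snd = u.snd + v.snd := rfl

lemma PreH.fst_smul (c : ℂ) (u : PreH) : (c • u).fst = c • u.fst := rfl

lemma PreH.snd_smul (c : ℂ) (u : PreH) : (c • u).snd = c • u.snd := rfl

lemma PreH.eq_of_eqOn {u v : PreH} (h1 : EqOn u.fst v.fst I01) (h2 : EqOn u.snd v.snd I01) :
    u = v := by
  apply Subtype.ext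
  apply Prod.ext
  · funext x
    have := h1 x.2
    simpa [PreH.fst, ext, IccExtend_of_mem _ _ x.2] using this
  · funext x
    have := h2 x.2
    simpa [PreH.snd, ext, IccExtend_of_mem _ _ x.2] using this

lemma PreH.snd_deriv_continuousOn (u : PreH) : ContinuousOn (derivWithin u.snd I01) I01 :=
  (u.snd_contDiffOn.derivWithin uniq (m := 0) (by norm_num)).continuousOn

lemma PreH.DD_continuousOn (u : PreH) : ContinuousOn (D (D u.fst)) (Ioc 0 1) :=
  YangMills.DD_continuousOn (u.fst_contDiffOn.of_le (by norm_num))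

lemma PreH.DD_mul_integrable (u v : PreH) :
    IntervalIntegrable (fun ρ => D (D v.fst) ρ * conj (D (D u.fst) ρ)) volume 0 1 := by
  rw [intervalIntegrable_iff_integrableOn_Ioc_of_le zero_le_one]
  obtain ⟨C, hC⟩ := DD_bound u.fst_contDiffOn u.fst_vanish
  obtain ⟨C', hC'⟩ := DD_bound v.fst_contDiffOn v.fst_vanish
  have hc : ContinuousOn (fun ρ => D (D v.fst) ρ * conj (D (D u.fst) ρ)) (Ioc 0 1) :=
    v.DD_continuousOn.mul (Complex.continuous_conj.comp_continuousOn u.DD_continuousOn)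
  refine IntegrableOn.of_bound (by simp) (hc.aestronglyMeasurable measurableSet_Ioc) (C' * C) ?_
  filter_upwards [ae_restrict_mem measurableSet_Ioc] with ρ hρ
  have hρ' := Ioc_subset_Icc_self hρ
  rw [norm_mul, RCLike.norm_conj]
  exact mul_le_mul (hC' ρ hρ') (hC ρ hρ') (norm_nonneg _) ((norm_nonneg _).trans (hC' ρ hρ'))

lemma PreH.snd_mul_integrable (u v : PreH) :
    IntervalIntegrable (fun ρ => derivWithin v.snd I01 ρ * conj (derivWithin u.snd I01 ρ))
      volume 0 1 := by
  apply ContinuousOn.intervalIntegrable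
  rw [uIcc_of_le zero_le_one]
  exact v.snd_deriv_continuousOn.mul
    (Complex.continuous_conj.comp_continuousOn u.snd_deriv_continuousOn)

/-- The sesquilinear form
`(v|u) = ∫₀¹ D²v₁ conj(D²u₁) dρ + ∫₀¹ v₂' conj(u₂') dρ` on `H̃`. In Mathlib's `inner ℂ u v` the
conjugate-linear slot is the first one. -/
instance : Inner ℂ PreH where
  inner u v := (∫ ρ in (0 : ℝ)..1, D (D v.fst) ρ * conj (D (D u.fst) ρ))
    + ∫ ρ in (0 : ℝ)..1, derivWithin v.snd I01 ρ * conj (derivWithin u.snd I01 ρ)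

lemma PreH.inner_def (u v : PreH) :
    inner ℂ u v = (∫ ρ in (0 : ℝ)..1, D (D v.fst) ρ * conj (D (D u.fst) ρ))
      + ∫ ρ in (0 : ℝ)..1, derivWithin v.snd I01 ρ * conj (derivWithin u.snd I01 ρ) := rfl

lemma PreH.inner_self (u : PreH) :
    inner ℂ u u = (((∫ ρ in (0 : ℝ)..1, ‖D (D u.fst) ρ‖ ^ 2)
      + ∫ ρ in (0 : ℝ)..1, ‖derivWithin u.snd I01 ρ‖ ^ 2 : ℝ) : ℂ) := by
  rw [PreH.inner_def]
  simp only [Complex.mul_conj', ← Complex.ofReal_pow, intervalIntegral.integral_ofReal,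
    Complex.ofReal_add]

lemma intervalIntegral_congr_I01 {f g : ℝ → ℂ} (h : EqOn f g I01) :
    ∫ ρ in (0 : ℝ)..1, f ρ = ∫ ρ in (0 : ℝ)..1, g ρ :=
  intervalIntegral.integral_congr (by rwa [uIcc_of_le zero_le_one])

lemma eq_zero_of_integral_sq {f : ℝ → ℂ} (hc : ContinuousOn f (Ioc 0 1))
    (hi : IntervalIntegrable (fun ρ => ‖f ρ‖ ^ 2) volume 0 1)
    (h : ∫ ρ in (0 : ℝ)..1, ‖f ρ‖ ^ 2 = 0) : ∀ ρ ∈ Ioc (0 : ℝ) 1, f ρ = 0 := by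
  rw [intervalIntegral.integral_eq_zero_iff_of_nonneg_ae (.of_forall fun _ => by positivity) hi,
    Ioc_eq_empty (by norm_num : ¬ (1 : ℝ) < 0), union_empty] at h
  intro ρ hρ
  have := Measure.eqOn_Ioc_of_ae_eq volume h (hc.norm.pow 2) continuousOn_const hρ
  simpa using this

lemma PreH.definite (u : PreH) (h : inner ℂ u u = 0) : u = 0 := by
  rw [PreH.inner_self, Complex.ofReal_eq_zero] at h
  have n1 : 0 ≤ ∫ ρ in (0 : ℝ)..1, ‖D (D u.fst) ρ‖ ^ 2 :=
    intervalIntegral.integral_nonneg zero_le_one fun _ _ => by positivity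
  have n2 : 0 ≤ ∫ ρ in (0 : ℝ)..1, ‖derivWithin u.snd I01 ρ‖ ^ 2 :=
    intervalIntegral.integral_nonneg zero_le_one fun _ _ => by positivity
  have sq : ∀ z : ℂ, ‖z * conj z‖ = ‖z‖ ^ 2 := fun z => by
    rw [norm_mul, RCLike.norm_conj, sq]
  have z1 := eq_zero_of_integral_sq u.DD_continuousOn
    (by simpa only [sq] using (u.DD_mul_integrable u).norm) (by linarith)
  have z2 := eq_zero_of_integral_sq (u.snd_deriv_continuousOn.mono Ioc_subset_Icc_self)
    (by simpa only [sq] using (u.snd_mul_integrable u).norm) (by linarith)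
  have cst : ∀ {f : ℝ → ℂ}, ContinuousOn f I01 → (∀ x ∈ Ioo (0 : ℝ) 1, HasDerivAt f 0 x) →
      f 0 = 0 → ∀ x ∈ I01, f x = 0 := by
    intro f hf hd h0 x hx
    have := intervalIntegral.integral_eq_sub_of_hasDerivAt_of_le (f := f) (f' := fun _ => 0) hx.1
      (hf.mono (Icc_subset_Icc_right hx.2)) (fun y hy => hd y ⟨hy.1, hy.2.trans_le hx.2⟩)
      (by simp)
    simpa [h0] using this.symm
  have nh : ∀ x ∈ Ioo (0 : ℝ) 1, I01 ∈ nhds x := fun x hx => Icc_mem_nhds hx.1 hx.2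
  have c1 : ContDiffOn ℝ 3 (derivWithin u.fst I01) I01 :=
    u.fst_contDiffOn.derivWithin uniq (by norm_num)
  obtain ⟨C, hC0, hC⟩ := taylor_zero (n := 2) (by norm_num; exact c1)
    fun k hk => by rw [iDW_deriv]; exact u.fst_vanish _ (by omega)
  have Dcont : ContinuousOn (D u.fst) I01 := by
    intro x hx
    rcases eq_or_lt_of_le hx.1 with h0 | h0
    · subst h0
      have hD0 : D u.fst 0 = 0 := by simp [D]
      rw [ContinuousWithinAt, hD0]
      refine squeeze_zero_norm' (a := fun x : ℝ => C * x ^ 2) ?_ ?_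
      · filter_upwards [self_mem_nhdsWithin] with y hy
        rcases eq_or_lt_of_le hy.1 with h0 | h0
        · rw [← h0, hD0]; simp
        · rw [D, norm_div, Complex.norm_of_nonneg hy.1, div_le_iff₀ h0]
          exact (hC y hy).trans_eq (by ring)
      · have : Continuous fun x : ℝ => C * x ^ 2 := by fun_prop
        have := this.continuousWithinAt (s := I01) (x := 0)
        simpa [ContinuousWithinAt] using this
    · exact (c1.continuousOn x hx).div Complex.continuous_ofReal.continuousWithinAt
        (by exact_mod_cast h0.ne')
  have Dzero : ∀ x ∈ I01, D u.fst x = 0 := by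
    refine cst Dcont (fun x hx => ?_) (by simp [D])
    have hx' : x ∈ I01 := Ioo_subset_Icc_self hx
    have hne : (x : ℂ) ≠ 0 := by exact_mod_cast hx.1.ne'
    have hd : DifferentiableWithinAt ℝ (D u.fst) I01 x :=
      (c1.differentiableOn (by norm_num) x hx').div
        (Complex.ofRealCLM.differentiableAt.differentiableWithinAt) hne
    have h0 := z1 x ⟨hx.1, hx.2.le⟩
    rw [D, div_eq_zero_iff, or_iff_left hne] at h0
    have := hd.hasDerivWithinAt
    rw [h0] at this
    exact this.hasDerivAt (nh x hx)
  refine PreH.eq_of_eqOn (cst u.fst_contDiffOn.continuousOn (fun x hx => ?_) ?_)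
    (cst u.snd_contDiffOn.continuousOn (fun x hx => ?_) u.snd_zero)
  · have hne : (x : ℂ) ≠ 0 := by exact_mod_cast hx.1.ne'
    have h0 := Dzero x (Ioo_subset_Icc_self hx)
    rw [D, div_eq_zero_iff, or_iff_left hne] at h0
    have := (u.fst_contDiffOn.differentiableOn (by norm_num) x
      (Ioo_subset_Icc_self hx)).hasDerivWithinAt
    rw [h0] at this
    exact this.hasDerivAt (nh x hx)
  · simpa using u.fst_vanish 0 (by norm_num)
  · have := (u.snd_contDiffOn.differentiableOn (by norm_num) x
      (Ioo_subset_Icc_self hx)).hasDerivWithinAt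
    rw [z2 x ⟨hx.1, hx.2.le⟩] at this
    exact this.hasDerivAt (nh x hx)

/-- `(·|·)` is an inner product on `H̃`. -/
@[reducible]
def PreH.core : InnerProductSpace.Core ℂ PreH where
  inner := inner ℂ
  conj_inner_symm u v := by
    simp only [PreH.inner_def, map_add, intervalIntegral.integral_of_le zero_le_one,
      ← integral_conj, map_mul, Complex.conj_conj, mul_comm]
  re_inner_nonneg u := by
    rw [PreH.inner_self]
    simp only [RCLike.re_to_complex, Complex.ofReal_re]
    exact add_nonneg (intervalIntegral.integral_nonneg zero_le_one fun _ _ => by positivity)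
      (intervalIntegral.integral_nonneg zero_le_one fun _ _ => by positivity)
  add_left u v w := by
    have h1 : EqOn (D (D (u + v).fst)) (D (D u.fst) + D (D v.fst)) I01 :=
      DD_add (u.fst_contDiffOn.of_le (by norm_num)) (v.fst_contDiffOn.of_le (by norm_num))
    have h2 : EqOn (derivWithin (u + v).snd I01)
        (derivWithin u.snd I01 + derivWithin v.snd I01) I01 := fun x hx =>
      derivWithin_add (u.snd_contDiffOn.differentiableOn (by norm_num) x hx)
        (v.snd_contDiffOn.differentiableOn (by norm_num) x hx)
    simp only [PreH.inner_def]
    rw [intervalIntegral_congr_I01 (g := fun ρ => D (D w.fst) ρ * conj (D (D u.fst) ρ)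
        + D (D w.fst) ρ * conj (D (D v.fst) ρ)),
      intervalIntegral_congr_I01 (f := fun ρ => _ * conj (derivWithin (u + v).snd I01 ρ))
        (g := fun ρ => derivWithin w.snd I01 ρ * conj (derivWithin u.snd I01 ρ)
        + derivWithin w.snd I01 ρ * conj (derivWithin v.snd I01 ρ)),
      intervalIntegral.integral_add (u.DD_mul_integrable w) (v.DD_mul_integrable w),
      intervalIntegral.integral_add (u.snd_mul_integrable w) (v.snd_mul_integrable w)]
    · ring
    · intro x hx
      simp only [h2 hx, Pi.add_apply, map_add, mul_add]
    · intro x hx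
      simp only [h1 hx, Pi.add_apply, map_add, mul_add]
  smul_left u v c := by
    simp only [PreH.inner_def, PreH.fst_smul, PreH.snd_smul, DD_smul, Pi.smul_apply, smul_eq_mul,
      derivWithin_const_smul_field, map_mul, mul_add, ← intervalIntegral.integral_const_mul]
    congr 1 <;> (congr 1; ext ρ; ring)
  definite := PreH.definite

instance : NormedAddCommGroup PreH := PreH.core.toNormedAddCommGroup

instance : InnerProductSpace ℂ PreH := InnerProductSpace.ofCore PreH.core.toCore

/-- The Hilbert space `H`: the completion of `H̃` with respect to `(·|·)`. -/
abbrev H : Type := UniformSpace.Completion PreH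

/-- The canonical embedding of `H̃` into `H`. -/
def emb : PreH →ₗ[ℂ] H := (UniformSpace.Completion.toComplₗᵢ : PreH →ₗᵢ[ℂ] H).toLinearMap

lemma emb_injective : Function.Injective emb :=
  (UniformSpace.Completion.toComplₗᵢ : PreH →ₗᵢ[ℂ] H).injective

/-! ### The free operator -/

/-- The domain `𝒟(L̃₀) ⊆ H̃`: pairs in `C^∞[0,1] × C^∞[0,1]` with `u₁^(k)(0) = u₂(0) = 0` for
`k = 0, …, 4`. -/
def smoothDomain : Submodule ℂ PreH where
  carrier := {u | ContDiffOn ℝ ∞ u.fst I01 ∧ ContDiffOn ℝ ∞ u.snd I01 ∧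
    (∀ k ≤ 4, iteratedDerivWithin k u.fst I01 0 = 0) ∧ u.snd 0 = 0}
  add_mem' := by
    rintro u v ⟨hu1, hu2, hu3, hu4⟩ ⟨hv1, hv2, hv3, hv4⟩
    refine ⟨hu1.add hv1, hu2.add hv2, fun k hk => ?_, (u + v).snd_zero⟩
    rw [PreH.fst_add, iteratedDerivWithin_add zero_mem uniq
      (smooth_le hu1 k 0 zero_mem) (smooth_le hv1 k 0 zero_mem), hu3 k hk, hv3 k hk, add_zero]
  zero_mem' := by
    refine ⟨contDiffOn_const, contDiffOn_const, fun k _ => ?_, rfl⟩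
    rw [show (0 : PreH).fst = 0 from rfl]
    simp
  smul_mem' := by
    rintro c u ⟨hu1, hu2, hu3, hu4⟩
    refine ⟨hu1.const_smul c, hu2.const_smul c, fun k hk => ?_, (c • u).snd_zero⟩
    rw [PreH.fst_smul, iteratedDerivWithin_const_smul zero_mem uniq c
      (smooth_le hu1 k 0 zero_mem), hu3 k hk, smul_zero]

/-- First component of `L̃₀ u`: `-ρ u₁'(ρ) + 2 u₁(ρ) + ρ² u₂(ρ) - 3 K u₂(ρ)`. -/
def freeFst (u : PreH) (ρ : ℝ) : ℂ :=
  -(ρ : ℂ) * derivWithin u.fst I01 ρ + 2 * u.fst ρ + (ρ : ℂ) ^ 2 * u.snd ρ - 3 * K u.snd ρ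

/-- Second component of `L̃₀ u`: `D² u₁(ρ) - ρ u₂'(ρ) - u₂(ρ)`. At `ρ = 0` the convention
`x / 0 = 0` gives `D² u₁(0) = 0`, which is the limit of `D² u₁` at `0` for `u` in the domain. -/
def freeSnd (u : PreH) (ρ : ℝ) : ℂ :=
  D (D u.fst) ρ - (ρ : ℂ) * derivWithin u.snd I01 ρ - u.snd ρ

lemma freeFst_smooth {u : PreH} (hu : u ∈ smoothDomain) : ContDiffOn ℝ ∞ (freeFst u) I01 :=
  ((((smooth_id.neg).mul (smooth_deriv hu.1)).add (contDiffOn_const.mul hu.1)).add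
    ((smooth_id.pow 2).mul hu.2.1)).sub (contDiffOn_const.mul (K_smooth hu.2.1))

/-- The cancellation `ρ² u₂ - 3 K u₂ = O(ρ⁴)`. -/
lemma cancellation {f : ℝ → ℂ} (hf : ContDiffOn ℝ ∞ f I01) (h0 : f 0 = 0) :
    ∃ C, 0 ≤ C ∧ ∀ x ∈ I01, ‖(x : ℂ) ^ 2 * f x - 3 * K f x‖ ≤ C * x ^ 4 := by
  let g : ℝ → ℂ := fun x => (x : ℂ) ^ 2 * f x - 3 * K f x
  have hg : ContDiffOn ℝ ∞ g I01 :=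
    ((smooth_id.pow 2).mul hf).sub (contDiffOn_const.mul (K_smooth hf))
  have hf' := smooth_deriv hf
  have hdg : EqOn (derivWithin g I01)
      (fun x => (x : ℂ) * ((x : ℂ) * derivWithin f I01 x - f x)) I01 := by
    intro x hx
    have d0 : HasDerivWithinAt (fun ρ : ℝ => (ρ : ℂ)) 1 I01 x :=
      (Complex.ofRealCLM.hasDerivAt (x := x)).hasDerivWithinAt
    have d1 : HasDerivWithinAt f (derivWithin f I01 x) I01 x :=
      (hf.differentiableOn (by simp) x hx).hasDerivWithinAt
    have d2 := ((d0.pow 2).mul d1).sub ((K_hasDeriv hf.continuousOn hx).const_mul 3)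
    have d3 : HasDerivWithinAt g _ I01 x := d2
    rw [d3.derivWithin (uniq x hx)]
    simp only [Pi.pow_apply]
    push_cast
    ring
  obtain ⟨C1, p1, b1⟩ := taylor_lead (n := 1) (mod_cast smooth_le hf 2)
    (fun k hk => by interval_cases k; simpa using h0)
  obtain ⟨C2, p2, b2⟩ := taylor_lead (n := 0) (mod_cast smooth_le hf' 1)
    (fun k hk => by omega)
  rw [iDW_deriv] at b2
  set a := iteratedDerivWithin 1 f I01 0
  have hb : ∀ x ∈ I01, ‖derivWithin g I01 x‖ ≤ (C2 + C1) * x ^ (2 + 1) := by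
    intro x hx
    have q1 := b1 x hx
    have q2 := b2 x hx
    rw [hdg hx]
    change ‖(x : ℂ) * ((x : ℂ) * derivWithin f I01 x - f x)‖ ≤ _
    simp only [Nat.factorial, Nat.cast_one, inv_one, one_mul, pow_zero, pow_one, one_smul,
      Complex.real_smul, Nat.reduceAdd, mul_one, zero_add] at q1 q2
    have : (x : ℂ) * ((x : ℂ) * derivWithin f I01 x - f x)
        = (x : ℂ) * ((x : ℂ) * (derivWithin f I01 x - a) - (f x - (x : ℂ) * a)) := by ring
    rw [this, norm_mul, Complex.norm_of_nonneg hx.1]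
    have h1 : ‖(x : ℂ) * (derivWithin f I01 x - a) - (f x - (x : ℂ) * a)‖
        ≤ x * (C2 * x) + C1 * x ^ 2 := by
      refine (norm_sub_le _ _).trans (add_le_add ?_ q1)
      rw [norm_mul, Complex.norm_of_nonneg hx.1]
      exact mul_le_mul_of_nonneg_left q2 hx.1
    exact (mul_le_mul_of_nonneg_left h1 hx.1).trans_eq (by ring)
  have hv := vanish_of_bound (smooth_deriv hg) hb
  obtain ⟨C, hC0, hC⟩ := taylor_zero (f := g) (n := 3) (mod_cast smooth_le hg 4) (by
    intro k hk
    rcases k with _ | k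
    · simp [g, K]
    · rw [← iDW_deriv]; exact hv k (by omega))
  exact ⟨C, hC0, hC⟩

lemma freeFst_vanish {u : PreH} (hu : u ∈ smoothDomain) :
    ∀ k ≤ 3, iteratedDerivWithin k (freeFst u) I01 0 = 0 := by
  obtain ⟨C1, p1, b1⟩ := taylor_zero (n := 3) (mod_cast smooth_le hu.1 4)
    fun k hk => hu.2.2.1 k (by omega)
  obtain ⟨C2, p2, b2⟩ := taylor_zero (n := 3) (mod_cast smooth_le (smooth_deriv hu.1) 4)
    fun k hk => by rw [iDW_deriv]; exact hu.2.2.1 _ (by omega)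
  obtain ⟨C3, p3, b3⟩ := cancellation hu.2.1 hu.2.2.2
  refine vanish_of_bound (freeFst_smooth hu) (C := C2 + 2 * C1 + C3) fun x hx => ?_
  have : freeFst u x = (-(x : ℂ) * derivWithin u.fst I01 x + 2 * u.fst x)
      + ((x : ℂ) ^ 2 * u.snd x - 3 * K u.snd x) := by rw [freeFst]; ring
  rw [this]
  refine (norm_add_le _ _).trans ((add_le_add (norm_add_le _ _) (b3 x hx)).trans ?_)
  rw [norm_mul, norm_mul, norm_neg, Complex.norm_of_nonneg hx.1, Complex.norm_ofNat]
  have h1 := b1 x hx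
  have h2 := b2 x hx
  have h3 : x * ‖derivWithin u.fst I01 x‖ ≤ 1 * ‖derivWithin u.fst I01 x‖ :=
    mul_le_mul_of_nonneg_right hx.2 (norm_nonneg _)
  norm_num at h1 h2 ⊢
  nlinarith

lemma freeSnd_contDiffOn {u : PreH} (hu : u ∈ smoothDomain) : ContDiffOn ℝ 1 (freeSnd u) I01 :=
  ((DD_contDiffOn hu.1 hu.2.2.1).sub (mod_cast smooth_le (smooth_id.mul (smooth_deriv hu.2.1)) 1)).sub
    u.snd_contDiffOn

lemma freeSnd_zero (u : PreH) : freeSnd u 0 = 0 := by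
  simp [freeSnd, D, u.snd_zero]

/-- The element of `H̃` with components `f`, `g`. -/
def mkPreH (f g : ℝ → ℂ) (hf : ContDiffOn ℝ 4 f I01) (hg : ContDiffOn ℝ 1 g I01)
    (hf0 : ∀ k ≤ 3, iteratedDerivWithin k f I01 0 = 0) (hg0 : g 0 = 0) : PreH :=
  ⟨(fun ρ => f ρ, fun ρ => g ρ), hf.congr (ext_restrict f), hg.congr (ext_restrict g),
    fun k hk => (iteratedDerivWithin_congr (ext_restrict f) zero_mem).trans (hf0 k hk),
    (ext_restrict g zero_mem).trans hg0⟩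

lemma mkPreH_fst (f g : ℝ → ℂ) (hf hg hf0 hg0) : EqOn (mkPreH f g hf hg hf0 hg0).fst f I01 :=
  ext_restrict f

lemma mkPreH_snd (f g : ℝ → ℂ) (hf hg hf0 hg0) : EqOn (mkPreH f g hf hg hf0 hg0).snd g I01 :=
  ext_restrict g

lemma freeFst_add {u v : PreH} : EqOn (freeFst (u + v)) (freeFst u + freeFst v) I01 := by
  intro x hx
  have h : derivWithin (u + v).fst I01 x = derivWithin u.fst I01 x + derivWithin v.fst I01 x :=
    derivWithin_add (u.fst_contDiffOn.differentiableOn (by norm_num) x hx)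
      (v.fst_contDiffOn.differentiableOn (by norm_num) x hx)
  have hK : K (u + v).snd x = K u.snd x + K v.snd x :=
    K_add u.snd_contDiffOn.continuousOn v.snd_contDiffOn.continuousOn hx
  rw [freeFst, h, hK]
  simp only [freeFst, PreH.fst_add, PreH.snd_add, Pi.add_apply]
  ring

lemma freeSnd_add {u v : PreH} : EqOn (freeSnd (u + v)) (freeSnd u + freeSnd v) I01 := by
  intro x hx
  have h : derivWithin (u + v).snd I01 x = derivWithin u.snd I01 x + derivWithin v.snd I01 x :=
    derivWithin_add (u.snd_contDiffOn.differentiableOn (by norm_num) x hx)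
      (v.snd_contDiffOn.differentiableOn (by norm_num) x hx)
  have hD : D (D (u + v).fst) x = D (D u.fst) x + D (D v.fst) x :=
    DD_add (u.fst_contDiffOn.of_le (by norm_num)) (v.fst_contDiffOn.of_le (by norm_num)) hx
  rw [freeSnd, h, hD]
  simp only [freeSnd, PreH.snd_add, Pi.add_apply]
  ring

lemma freeFst_smul (c : ℂ) (u : PreH) : freeFst (c • u) = c • freeFst u := by
  ext x
  simp only [freeFst, PreH.fst_smul, PreH.snd_smul, derivWithin_const_smul_field, K_smul,
    Pi.smul_apply, smul_eq_mul]
  ring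

lemma freeSnd_smul (c : ℂ) (u : PreH) : freeSnd (c • u) = c • freeSnd u := by
  ext x
  simp only [freeSnd, PreH.fst_smul, PreH.snd_smul, derivWithin_const_smul_field, DD_smul,
    Pi.smul_apply, smul_eq_mul]
  ring

/-- The differential operator `L̃₀ : 𝒟(L̃₀) → H̃`. -/
def freeMap : smoothDomain →ₗ[ℂ] PreH where
  toFun u := mkPreH (freeFst u) (freeSnd u) (mod_cast smooth_le (freeFst_smooth u.2) 4)
    (freeSnd_contDiffOn u.2) (freeFst_vanish u.2) (freeSnd_zero u)
  map_add' u v := PreH.eq_of_eqOn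
    (fun x hx => by
      rw [mkPreH_fst _ _ _ _ _ _ hx, PreH.fst_add, Pi.add_apply, mkPreH_fst _ _ _ _ _ _ hx,
        mkPreH_fst _ _ _ _ _ _ hx]
      exact freeFst_add hx)
    (fun x hx => by
      rw [mkPreH_snd _ _ _ _ _ _ hx, PreH.snd_add, Pi.add_apply, mkPreH_snd _ _ _ _ _ _ hx,
        mkPreH_snd _ _ _ _ _ _ hx]
      exact freeSnd_add hx)
  map_smul' c u := PreH.eq_of_eqOn
    (fun x hx => by
      rw [mkPreH_fst _ _ _ _ _ _ hx, RingHom.id_apply, PreH.fst_smul, Pi.smul_apply,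
        mkPreH_fst _ _ _ _ _ _ hx, Submodule.coe_smul, freeFst_smul, Pi.smul_apply])
    (fun x hx => by
      rw [mkPreH_snd _ _ _ _ _ _ hx, RingHom.id_apply, PreH.snd_smul, Pi.smul_apply,
        mkPreH_snd _ _ _ _ _ _ hx, Submodule.coe_smul, freeSnd_smul, Pi.smul_apply])

/-- The embedding of `𝒟(L̃₀)` into `H`. -/
def embDomain : smoothDomain →ₗ[ℂ] H := emb ∘ₗ smoothDomain.subtype

lemma embDomain_injective : Function.Injective embDomain :=
  emb_injective.comp smoothDomain.injective_subtype

/-- `L̃₀` as a densely defined operator in `H`, with domain (the image of) `𝒟(L̃₀)`. -/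
def L0tilde : H →ₗ.[ℂ] H where
  domain := LinearMap.range embDomain
  toFun := emb ∘ₗ freeMap ∘ₗ
    (LinearEquiv.ofInjective embDomain embDomain_injective).symm.toLinearMap

/-- The free generator `L₀`: the closure of `L̃₀`. -/
def L0 : H →ₗ.[ℂ] H := L0tilde.closure

/-! ### The potential term and the linearized generator -/

lemma smooth_ofReal {V : ℝ → ℝ} (hV : ContDiffOn ℝ ∞ V I01) :
    ContDiffOn ℝ ∞ (fun ρ => (V ρ : ℂ)) I01 :=
  Complex.ofRealCLM.contDiff.comp_contDiffOn hV

/-- First component of `L' u`: `-V(ρ) K² u₂(ρ)`. The second one is `0`. -/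
def potFst (V : ℝ → ℝ) (u : PreH) (ρ : ℝ) : ℂ := -(V ρ : ℂ) * K (K u.snd) ρ

lemma potFst_smooth {V : ℝ → ℝ} (hV : ContDiffOn ℝ ∞ V I01) {u : PreH} (hu : u ∈ smoothDomain) :
    ContDiffOn ℝ ∞ (potFst V u) I01 :=
  (smooth_ofReal hV).neg.mul (K_smooth (K_smooth hu.2.1))

lemma potFst_vanish {V : ℝ → ℝ} (hV : ContDiffOn ℝ ∞ V I01) {u : PreH} (hu : u ∈ smoothDomain) :
    ∀ k ≤ 3, iteratedDerivWithin k (potFst V u) I01 0 = 0 := by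
  obtain ⟨C, hC0, hC⟩ := taylor_zero (n := 0) (mod_cast smooth_le hu.2.1 1)
    (fun k hk => by obtain rfl : k = 0 := (by omega); simpa using u.snd_zero)
  obtain ⟨M, hM⟩ := isCompact_Icc.exists_bound_of_continuousOn (smooth_ofReal hV).continuousOn
  have hK := K_bound hC0 (K_bound hC0 hC)
  refine fun k hk => vanish_of_bound (n := 4) (potFst_smooth hV hu) (C := M * C)
    (fun x hx => ?_) k (by omega)
  rw [potFst, norm_mul, norm_neg, mul_assoc]
  exact mul_le_mul (hM x hx) (hK x hx) (norm_nonneg _) ((norm_nonneg _).trans (hM x hx))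

/-- The potential term `u ↦ (-V K² u₂, 0)` as a map `𝒟(L̃₀) → H̃`, for `V ∈ C^∞[0,1]`. -/
def potMap (V : ℝ → ℝ) (hV : ContDiffOn ℝ ∞ V I01) : smoothDomain →ₗ[ℂ] PreH where
  toFun u := mkPreH (potFst V u) 0 (mod_cast smooth_le (potFst_smooth hV u.2) 4)
    contDiffOn_const (potFst_vanish hV u.2) rfl
  map_add' u v := PreH.eq_of_eqOn
    (fun x hx => by
      have hu := u.1.snd_contDiffOn.continuousOn
      have hv := v.1.snd_contDiffOn.continuousOn
      have kc : ∀ {f : ℝ → ℂ}, ContinuousOn f I01 → ContinuousOn (K f) I01 := fun hf x hx =>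
        (K_hasDeriv hf hx).continuousWithinAt
      have hK : K (K (u.1 + v.1).snd) x = K (K u.1.snd) x + K (K v.1.snd) x := by
        rw [PreH.snd_add, K_congr (K_add hu hv) hx, K_add (kc hu) (kc hv) hx, Pi.add_apply]
      rw [mkPreH_fst _ _ _ _ _ _ hx, PreH.fst_add, Pi.add_apply, mkPreH_fst _ _ _ _ _ _ hx,
        mkPreH_fst _ _ _ _ _ _ hx]
      simp only [potFst, Submodule.coe_add, hK]
      ring)
    (fun x hx => by
      rw [mkPreH_snd _ _ _ _ _ _ hx, PreH.snd_add, Pi.add_apply, mkPreH_snd _ _ _ _ _ _ hx,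
        mkPreH_snd _ _ _ _ _ _ hx]
      simp)
  map_smul' c u := PreH.eq_of_eqOn
    (fun x hx => by
      rw [mkPreH_fst _ _ _ _ _ _ hx, RingHom.id_apply, PreH.fst_smul, Pi.smul_apply,
        mkPreH_fst _ _ _ _ _ _ hx]
      simp only [potFst, Submodule.coe_smul, PreH.snd_smul, K_smul, Pi.smul_apply, smul_eq_mul]
      ring)
    (fun x hx => by
      rw [mkPreH_snd _ _ _ _ _ _ hx, RingHom.id_apply, PreH.snd_smul, Pi.smul_apply,
        mkPreH_snd _ _ _ _ _ _ hx]
      simp)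

/-- The bounded operator `L' ∈ ℬ(H)`: the continuous extension to `H` of
`u ↦ (-V K² u₂, 0)` from the dense subspace `𝒟(L̃₀)`. -/
def Lprime (V : ℝ → ℝ) (hV : ContDiffOn ℝ ∞ V I01) : H →L[ℂ] H :=
  (emb ∘ₗ potMap V hV).extendOfNorm embDomain

/-- The linearized generator `L = L₀ + L'` with potential `V`, on `𝒟(L) = 𝒟(L₀)`. -/
def L (V : ℝ → ℝ) (hV : ContDiffOn ℝ ∞ V I01) : H →ₗ.[ℂ] H :=
  (Lprime V hV : H →ₗ[ℂ] H) +ᵥ L0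

/-- The ground state `W₀(ρ) = (1 - ρ²) / (1 + (3/5) ρ²)`. -/
def W0 (ρ : ℝ) : ℝ := (1 - ρ ^ 2) / (1 + 3 / 5 * ρ ^ 2)

/-- The nonlinearity `F(ψ) = ψ (ψ + 1) (ψ + 2)`. -/
def F (ψ : ℝ) : ℝ := ψ * (ψ + 1) * (ψ + 2)

/-- The Yang–Mills potential `V(ρ) = -144 (5 - ρ²) / (5 + 3ρ²)²`. -/
def ymPotential (ρ : ℝ) : ℝ := -144 * ((5 - ρ ^ 2) / (5 + 3 * ρ ^ 2) ^ 2)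

/-- `V(ρ) = (3 F'(W₀(ρ) - 1) - 6) / ρ²`. -/
lemma ymPotential_eq {ρ : ℝ} (hρ : ρ ≠ 0) :
    ymPotential ρ = (3 * deriv F (W0 ρ - 1) - 6) / ρ ^ 2 := by
  have hF : ∀ x : ℝ, deriv F x = 3 * x ^ 2 + 6 * x + 2 := by
    intro x
    have h := (((hasDerivAt_id x).mul ((hasDerivAt_id x).add_const 1)).mul
      ((hasDerivAt_id x).add_const 2)).deriv
    have hF : F = (id * (fun x => id x + 1)) * fun x => id x + 2 := rfl
    rw [hF, h]
    simp
    ring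
  rw [hF, W0, ymPotential]
  have h1 : (1 + 3 / 5 * ρ ^ 2) ≠ 0 := by positivity
  have h2 : (5 + 3 * ρ ^ 2) ≠ 0 := by positivity
  have h3 : (1 + 3 / 5 * ρ ^ 2) = (5 + 3 * ρ ^ 2) / 5 := by ring
  rw [h3]
  field_simp
  ring

lemma ymPotential_contDiffOn : ContDiffOn ℝ ∞ ymPotential I01 := by
  refine ContDiff.contDiffOn (contDiff_const.mul (ContDiff.div (by fun_prop) (by fun_prop) ?_))
  intro x
  positivity

/-! ### Resolvent and eigenvalues of an unbounded operator -/

/-- `R` is the resolvent `R_A(z) = (z - A)⁻¹` of `A` at `z`: a bounded operator which is a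
two-sided inverse of `z - A : 𝒟(A) → H`. If such an `R` exists, then `z` is in the resolvent set
of `A` and `R` is unique. -/
def IsResolvent (A : H →ₗ.[ℂ] H) (z : ℂ) (R : H →L[ℂ] H) : Prop :=
  (∀ f : H, ∃ u : A.domain, (u : H) = R f ∧ z • (u : H) - A u = f) ∧
    ∀ u : A.domain, R (z • (u : H) - A u) = u

/-- `z` is an eigenvalue of `A`, i.e. `z ∈ σ_p(A)`. -/
def IsEigenvalue (A : H →ₗ.[ℂ] H) (z : ℂ) : Prop :=
  ∃ u : A.domain, (u : H) ≠ 0 ∧ A u = z • (u : H)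

end

end YangMills

/-!
In the variables `v = D² u₁`, `w = u₂'` the energy norm is the norm of `L²(0,1)²` and the free
generator becomes the symmetric hyperbolic operator `(v, w) ↦ (-ρ v' - 2 v + w', v' - 2 w - ρ w')`
with boundary condition `v(0) = 0` (`DD_freeMap`, `derivWithin_freeMap_snd`). An integration by parts
shows that it is dissipative with constant `3/2` (`freeMap_dissipative`). For polynomial data the
equation `(z - L₀) u = f` decouples in `v + w` and `v - w` and has explicit smooth solutions
(`exists_solution_polynomial`), and elements with polynomial data are dense
(`dense_of_polynomial_data`). Hence `L̃₀` is closable, and every `z` with `Re z > -3/2` is in the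
resolvent set of `L₀`, with `‖R(z)‖ ≤ (Re z + 3/2)⁻¹` (`exists_resolvent_closure`).

The potential term is controlled by the `L²` norm of `u₂` alone (`exists_norm_potMap_le`). The second
component of `(z - L₀) u = f` expresses `z u₂` through quantities that are bounded in `L²` by
`‖u‖ + ‖f‖` (`norm_sq_mul_integral_snd_sq_le`), so `‖L' R(z)‖ = O(|z|⁻¹)` uniformly for
`Re z ≥ -3/2 + ε`. For `|z|` large a Neumann series inverts `1 - L' R(z)` and gives the resolvent of
`L` (`exists_resolvent_vadd`). Nothing here uses the form of the potential. A point of the resolvent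
set is not an eigenvalue, which gives the second assertion.
-/

namespace YangMills

open Set MeasureTheory
open scoped ComplexConjugate

/-! ### Closures and resolvents of dissipative operators -/

section Dissipative

variable {E : Type*} [NormedAddCommGroup E] [InnerProductSpace ℂ E]

/-- If `Re (T u | u) ≤ -γ ‖u‖²` on the domain of `T`, then `z - T` is bounded below by `Re z + γ`. -/
lemma lower_bound_of_dissipative {T : E →ₗ.[ℂ] E} {γ : ℝ}
    (hdiss : ∀ u : T.domain, (inner ℂ (u : E) (T u)).re ≤ -γ * ‖(u : E)‖ ^ 2) (z : ℂ)
    (u : T.domain) : (z.re + γ) * ‖(u : E)‖ ≤ ‖z • (u : E) - T u‖ := by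
  have h1 : (inner ℂ (u : E) (z • (u : E) - T u)).re
      = z.re * ‖(u : E)‖ ^ 2 - (inner ℂ (u : E) (T u)).re := by
    have hself : inner ℂ (u : E) (u : E) = ((‖(u : E)‖ ^ 2 : ℝ) : ℂ) := by
      rw [inner_self_eq_norm_sq_to_K]; simp
    rw [inner_sub_right, inner_smul_right, hself, Complex.sub_re, Complex.re_mul_ofReal]
  have h2 : (inner ℂ (u : E) (z • (u : E) - T u)).re ≤ ‖(u : E)‖ * ‖z • (u : E) - T u‖ :=
    (Complex.re_le_norm _).trans (norm_inner_le_norm _ _)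
  rcases eq_or_lt_of_le (norm_nonneg (u : E)) with h0 | h0
  · rw [← h0, mul_zero]; exact norm_nonneg _
  · refine le_of_mul_le_mul_left ?_ h0
    nlinarith [hdiss u]

/-- A densely defined dissipative operator is closable: if `(0, y)` lies in the closure of the
graph, then so does `(0, y) + t (x, T x)` for every `x` in the domain and every real `t`, and
dissipativity at this point for small `t` of either sign forces `Re (y | x) = 0`. -/
lemma isClosable_of_dissipative {T : E →ₗ.[ℂ] E} {γ : ℝ}
    (hdiss : ∀ u : T.domain, (inner ℂ (u : E) (T u)).re ≤ -γ * ‖(u : E)‖ ^ 2)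
    (hdense : Dense (T.domain : Set E)) : T.IsClosable := by
  have hcl : ∀ p ∈ T.graph.topologicalClosure,
      (inner ℂ p.1 p.2).re ≤ -γ * ‖p.1‖ ^ 2 := by
    intro p hp
    have hclosed : IsClosed {p : E × E | (inner ℂ p.1 p.2).re ≤ -γ * ‖p.1‖ ^ 2} :=
      isClosed_le (Complex.continuous_re.comp (continuous_fst.inner continuous_snd))
        (by fun_prop)
    have hsub : (T.graph : Set (E × E)) ⊆ {p : E × E | (inner ℂ p.1 p.2).re ≤ -γ * ‖p.1‖ ^ 2} := by
      rintro ⟨x, y⟩ hxy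
      obtain ⟨u, hu1, hu2⟩ := (LinearPMap.mem_graph_iff T).1 hxy
      simp only at hu1 hu2
      simp only [mem_ofPred_eq, ← hu1, ← hu2]
      exact hdiss u
    exact closure_minimal hsub hclosed hp
  refine ⟨T.graph.topologicalClosure.toLinearPMap,
    (Submodule.toLinearPMap_graph_eq _ ?_).symm⟩
  rintro ⟨x, y⟩ hxy (rfl : x = 0)
  have key : ∀ u : T.domain, (inner ℂ (u : E) y).re = 0 := by
    intro u
    have hmem : ((u : E), T u) ∈ T.graph.topologicalClosure :=
      T.graph.le_topologicalClosure (T.mem_graph u)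
    set c := (inner ℂ (u : E) y).re
    set d := (inner ℂ (u : E) (T u)).re
    have ht : ∀ t : ℝ, t * c ≤ (-γ * ‖(u : E)‖ ^ 2 - d) * t ^ 2 := by
      intro t
      have h1 := hcl _ (add_mem hxy (Submodule.smul_mem _ (t : ℂ) hmem))
      simp only [Prod.smul_mk, Prod.mk_add_mk, zero_add, inner_add_right, inner_smul_left,
        inner_smul_right, norm_smul, Complex.conj_ofReal, Complex.add_re, Complex.re_ofReal_mul,
        Complex.norm_real, mul_pow, Real.norm_eq_abs, sq_abs] at h1
      change t * c + t * (t * d) ≤ _ at h1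
      nlinarith
    set M := -γ * ‖(u : E)‖ ^ 2 - d
    by_contra hc
    have hpos : 0 < |c| := abs_pos.2 hc
    have h2 := ht (c / (|M| + 1))
    have hM : 0 < |M| + 1 := by positivity
    have h3 : c / (|M| + 1) * c = c ^ 2 / (|M| + 1) := by ring
    have h4 : M * (c / (|M| + 1)) ^ 2 ≤ c ^ 2 / (|M| + 1) * (|M| / (|M| + 1)) := by
      have : c ^ 2 / (|M| + 1) * (|M| / (|M| + 1)) = |M| * (c / (|M| + 1)) ^ 2 := by
        field_simp
      rw [this]
      exact mul_le_mul_of_nonneg_right (le_abs_self _) (by positivity)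
    have h5 : 0 < c ^ 2 / (|M| + 1) := by positivity
    have h6 : |M| / (|M| + 1) < 1 := (div_lt_one hM).2 (by linarith)
    nlinarith
  have hall : ∀ x : E, (inner ℂ x y).re = 0 := fun x =>
    hdense.induction (P := fun x => (inner ℂ x y).re = 0) (fun x hx => key ⟨x, hx⟩)
      (isClosed_eq (Complex.continuous_re.comp (continuous_id.inner continuous_const))
        continuous_const) x
  have := hall y
  change RCLike.re (inner ℂ y y) = 0 at this
  rw [inner_self_eq_norm_sq] at this
  exact norm_eq_zero.1 (pow_eq_zero_iff two_ne_zero |>.1 this)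

/-- The resolvent of the closure of a densely defined dissipative operator `T` at a point `z` with
`Re z > -γ` at which `z - T` has dense range. An estimate for a bounded operator `B` in terms of
`z - T` on the domain of `T` becomes an estimate for `B (z - T)⁻¹`. -/
lemma exists_resolvent_closure [CompleteSpace E] {T : E →ₗ.[ℂ] E} {γ : ℝ}
    (hdiss : ∀ u : T.domain, (inner ℂ (u : E) (T u)).re ≤ -γ * ‖(u : E)‖ ^ 2)
    (hdense : Dense (T.domain : Set E)) {z : ℂ} (hz : 0 < z.re + γ)
    (hrange : DenseRange fun u : T.domain => z • (u : E) - T u) :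
    ∃ R : E →L[ℂ] E, ((∀ f : E, ∃ u : T.closure.domain, (u : E) = R f ∧ z • (u : E) - T.closure u = f) ∧
        ∀ u : T.closure.domain, R (z • (u : E) - T.closure u) = u) ∧ ‖R‖ ≤ (z.re + γ)⁻¹ ∧
      ∀ (B : E →L[ℂ] E) (κ : ℝ), 0 ≤ κ →
        (∀ u : T.domain, ‖B u‖ ≤ κ * ‖z • (u : E) - T u‖) → ‖B.comp R‖ ≤ κ := by
  have hcl := isClosable_of_dissipative hdiss hdense
  have hgr := hcl.graph_closure_eq_closure_graph
  let S : T.domain →ₗ[ℂ] E := z • T.domain.subtype - T.toFun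
  have hS : ∀ u : T.domain, S u = z • (u : E) - T u := fun u => rfl
  have hSd : DenseRange S := hrange
  have hb : ∀ u : T.domain, ‖T.domain.subtype u‖ ≤ (z.re + γ)⁻¹ * ‖S u‖ := by
    intro u
    rw [inv_mul_eq_div, le_div_iff₀ hz, mul_comm, hS]
    exact lower_bound_of_dissipative hdiss z u
  let R : E →L[ℂ] E := T.domain.subtype.extendOfNorm S
  have hRS : ∀ u : T.domain, R (S u) = u := fun u =>
    LinearMap.extendOfNorm_eq hSd ⟨_, hb⟩ u
  refine ⟨R, ⟨fun f => ?_, fun u => ?_⟩,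
    LinearMap.opNorm_extendOfNorm_le hSd (inv_nonneg.2 hz.le) hb, fun B κ hκ hB => ?_⟩
  · have hmem : (R f, z • R f - f) ∈ T.closure.graph := by
      rw [← hgr]
      refine hSd.induction (P := fun f => (R f, z • R f - f) ∈ T.graph.topologicalClosure)
        ?_ (T.graph.isClosed_topologicalClosure.preimage
          (by fun_prop : Continuous fun f => (R f, z • R f - f))) f
      rintro _ ⟨u, rfl⟩
      apply T.graph.le_topologicalClosure
      rw [hRS, hS, sub_sub_cancel]
      exact T.mem_graph u
    obtain ⟨u, hu1, hu2⟩ := (LinearPMap.mem_graph_iff _).1 hmem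
    simp only at hu1 hu2
    exact ⟨u, hu1, by rw [hu1, hu2, sub_sub_cancel]⟩
  · have hclosed : IsClosed {p : E × E | R (z • p.1 - p.2) = p.1} :=
      isClosed_eq (by fun_prop) (by fun_prop)
    have hsub : (T.graph : Set (E × E)) ⊆ {p : E × E | R (z • p.1 - p.2) = p.1} := by
      rintro ⟨x, y⟩ hxy
      obtain ⟨u, hu1, hu2⟩ := (LinearPMap.mem_graph_iff T).1 hxy
      simp only at hu1 hu2
      simp only [mem_ofPred_eq, ← hu1, ← hu2]
      exact hRS u
    have hmem : ((u : E), T.closure u) ∈ T.graph.topologicalClosure := by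
      rw [hgr]; exact T.closure.mem_graph u
    exact closure_minimal hsub hclosed hmem
  · refine ContinuousLinearMap.opNorm_le_bound _ hκ fun f => ?_
    refine hSd.induction (P := fun f => ‖B.comp R f‖ ≤ κ * ‖f‖) ?_
      (isClosed_le (by fun_prop) (by fun_prop)) f
    rintro _ ⟨u, rfl⟩
    rw [ContinuousLinearMap.comp_apply, hRS, hS]
    exact hB u

end Dissipative

/-- If `R` is the resolvent of `A` at `z` and `‖B R‖ ≤ 1/2`, then `R (1 - B R)⁻¹`, given by the
Neumann series, is the resolvent of `A + B` at `z`. -/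
lemma exists_resolvent_vadd {A : H →ₗ.[ℂ] H} {z : ℂ} {R : H →L[ℂ] H} (hR : IsResolvent A z R)
    (B : H →L[ℂ] H) (hB : ‖B.comp R‖ ≤ 1 / 2) :
    ∃ R' : H →L[ℂ] H, IsResolvent ((B : H →ₗ[ℂ] H) +ᵥ A) z R' ∧ ‖R'‖ ≤ 2 * ‖R‖ := by
  have hlt : ‖B * R‖ < 1 := lt_of_le_of_lt hB (by norm_num)
  let U := Units.oneSub (B * R) hlt
  let G : H →L[ℂ] H := ↑U⁻¹
  have hU : ∀ f, (U : H →L[ℂ] H) f = f - B (R f) := fun f => rfl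
  have hUG : ∀ f, G f - B (R (G f)) = f := fun f => by
    rw [← hU, ← mul_apply_eq_comp, U.mul_inv]; rfl
  have hGU : ∀ f, G (f - B (R f)) = f := fun f => by
    rw [← hU, ← mul_apply_eq_comp, U.inv_mul]; rfl
  refine ⟨R.comp G, ⟨fun f => ?_, fun u => ?_⟩, ?_⟩
  · obtain ⟨u, hu1, hu2⟩ := hR.1 (G f)
    refine ⟨u, hu1, ?_⟩
    change z • (u : H) - (B u + A u) = f
    rw [← sub_sub, sub_right_comm, hu2, hu1]
    exact hUG f
  · change R (G (z • (u : H) - (B u + A u))) = u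
    have h1 := hR.2 u
    have h2 := hGU (z • (u : H) - A u)
    rw [h1, sub_right_comm, sub_sub] at h2
    rw [h2]
    exact h1
  · have hG : ‖G‖ ≤ 2 := by
      refine ContinuousLinearMap.opNorm_le_bound _ (by norm_num) fun f => ?_
      have h1 : ‖B (R (G f))‖ ≤ 1 / 2 * ‖G f‖ := (B.comp R).le_of_opNorm_le hB _
      have h2 : ‖G f‖ ≤ ‖f‖ + ‖B (R (G f))‖ := by
        nth_rewrite 1 [← sub_add_cancel (G f) (B (R (G f)))]
        rw [hUG]
        exact norm_add_le _ _
      linarith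
    calc ‖R.comp G‖ ≤ ‖R‖ * ‖G‖ := ContinuousLinearMap.opNorm_comp_le _ _
      _ ≤ ‖R‖ * 2 := mul_le_mul_of_nonneg_left hG (norm_nonneg _)
      _ = 2 * ‖R‖ := mul_comm _ _

lemma IsResolvent.not_isEigenvalue {A : H →ₗ.[ℂ] H} {z : ℂ} {R : H →L[ℂ] H}
    (hR : IsResolvent A z R) : ¬ IsEigenvalue A z := by
  rintro ⟨u, hu0, hu⟩
  have := hR.2 u
  rw [hu, sub_self, map_zero] at this
  exact hu0 this.symm

/-! ### The energy norm and the generator in the variables `D² u₁`, `u₂'` -/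

lemma PreH.norm_sq_eq (u : PreH) :
    ‖u‖ ^ 2 = (∫ ρ in (0 : ℝ)..1, ‖D (D u.fst) ρ‖ ^ 2)
      + ∫ ρ in (0 : ℝ)..1, ‖derivWithin u.snd I01 ρ‖ ^ 2 := by
  rw [← inner_self_eq_norm_sq (𝕜 := ℂ)]
  change RCLike.re (inner ℂ u u : ℂ) = _
  rw [PreH.inner_self]
  exact Complex.ofReal_re _

lemma D_of_hasDerivWithinAt {f : ℝ → ℂ} {a : ℂ} {ρ : ℝ} (hρ : ρ ∈ Ioc (0 : ℝ) 1)
    (h : HasDerivWithinAt f ((ρ : ℂ) * a) I01 ρ) : D f ρ = a := by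
  have hne : (ρ : ℂ) ≠ 0 := by exact_mod_cast hρ.1.ne'
  rw [D, h.derivWithin (uniq ρ (Ioc_subset_Icc_self hρ)), mul_div_cancel_left₀ _ hne]

lemma Ioc_mem_nhdsWithin_I01 {ρ : ℝ} (hρ : ρ ∈ Ioc (0 : ℝ) 1) : Ioc (0 : ℝ) 1 ∈ nhdsWithin ρ I01 := by
  filter_upwards [self_mem_nhdsWithin, mem_nhdsWithin_of_mem_nhds (Ioi_mem_nhds hρ.1)] with x h1 h2
  exact ⟨h2, h1.2⟩

/-- `D² f = v` on `(0,1]` as soon as `f' = ρ p` and `p' = ρ v` there. -/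
lemma DD_of_hasDerivWithinAt {f p v : ℝ → ℂ}
    (h1 : ∀ ρ ∈ Ioc (0 : ℝ) 1, HasDerivWithinAt f ((ρ : ℂ) * p ρ) I01 ρ)
    (h2 : ∀ ρ ∈ Ioc (0 : ℝ) 1, HasDerivWithinAt p ((ρ : ℂ) * v ρ) I01 ρ) :
    ∀ ρ ∈ Ioc (0 : ℝ) 1, D (D f) ρ = v ρ := fun ρ hρ =>
  D_of_hasDerivWithinAt hρ <| (h2 ρ hρ).congr_of_eventuallyEq
    (Filter.mem_of_superset (Ioc_mem_nhdsWithin_I01 hρ) fun x hx => D_of_hasDerivWithinAt hx (h1 x hx))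
    (D_of_hasDerivWithinAt hρ (h1 ρ hρ))

lemma hasDerivWithinAt_ofReal (ρ : ℝ) : HasDerivWithinAt (fun x : ℝ => (x : ℂ)) 1 I01 ρ :=
  (Complex.ofRealCLM.hasDerivAt (x := ρ)).hasDerivWithinAt

lemma hasDerivWithinAt_mul_D {f : ℝ → ℂ} {ρ : ℝ} (hρ : ρ ∈ Ioc (0 : ℝ) 1)
    (hf : DifferentiableWithinAt ℝ f I01 ρ) : HasDerivWithinAt f ((ρ : ℂ) * D f ρ) I01 ρ := by
  have hne : (ρ : ℂ) ≠ 0 := by exact_mod_cast hρ.1.ne'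
  rw [D, mul_div_cancel₀ _ hne]
  exact hf.hasDerivWithinAt

lemma D_differentiableWithinAt {f : ℝ → ℂ} (hf : ContDiffOn ℝ 2 f I01) {ρ : ℝ}
    (hρ : ρ ∈ Ioc (0 : ℝ) 1) : DifferentiableWithinAt ℝ (D f) I01 ρ :=
  ((hf.derivWithin uniq (m := 1) (by norm_num)).differentiableOn (by norm_num) ρ
    (Ioc_subset_Icc_self hρ)).div (hasDerivWithinAt_ofReal ρ).differentiableWithinAt
    (by exact_mod_cast hρ.1.ne')

lemma hasDerivWithinAt_of_contDiffOn {f : ℝ → ℂ} (hf : ContDiffOn ℝ 1 f I01) {ρ : ℝ}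
    (hρ : ρ ∈ I01) : HasDerivWithinAt f (derivWithin f I01 ρ) I01 ρ :=
  (hf.differentiableOn (by norm_num) ρ hρ).hasDerivWithinAt

lemma freeMap_fst (u : smoothDomain) : EqOn (freeMap u).fst (freeFst u) I01 :=
  ext_restrict (freeFst u)

lemma freeMap_snd (u : smoothDomain) : EqOn (freeMap u).snd (freeSnd u) I01 :=
  ext_restrict (freeSnd u)

/-- In the variables `v = D² u₁`, `w = u₂'` the first component of the free operator is
`-ρ v' - 2 v + w'`. -/
lemma DD_freeMap (u : smoothDomain) {ρ : ℝ} (hρ : ρ ∈ Ioc (0 : ℝ) 1) :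
    D (D (freeMap u).fst) ρ = -(ρ : ℂ) * derivWithin (D (D u.1.fst)) I01 ρ
      - 2 * D (D u.1.fst) ρ + derivWithin (derivWithin u.1.snd I01) I01 ρ := by
  have hf2 : ContDiffOn ℝ 2 u.1.fst I01 := mod_cast smooth_le u.2.1 2
  have hv := DD_contDiffOn u.2.1 u.2.2.2.1
  refine DD_of_hasDerivWithinAt
    (p := fun x => -(x : ℂ) ^ 2 * D (D u.1.fst) x - u.1.snd x
      + (x : ℂ) * derivWithin u.1.snd I01 x)
    (v := fun x => -(x : ℂ) * derivWithin (D (D u.1.fst)) I01 x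
      - 2 * D (D u.1.fst) x + derivWithin (derivWithin u.1.snd I01) I01 x)
    (fun x hx => ?_) (fun x hx => ?_) ρ hρ
  · have hx' := Ioc_subset_Icc_self hx
    have d0 := hasDerivWithinAt_ofReal x
    have d1 := hasDerivWithinAt_mul_D hx (hf2.differentiableOn (by norm_num) x hx')
    have d2 := hasDerivWithinAt_mul_D hx (D_differentiableWithinAt hf2 hx)
    have d3 := hasDerivWithinAt_of_contDiffOn u.1.snd_contDiffOn hx'
    have d4 := K_hasDeriv u.1.snd_contDiffOn.continuousOn hx'
    have d5 : HasDerivWithinAt (fun x : ℝ => -(x : ℂ) ^ 2 * D u.1.fst x + 2 * u.1.fst x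
      + (x : ℂ) ^ 2 * u.1.snd x - 3 * K u.1.snd x) _ I01 x :=
      (((d0.pow 2).neg.mul d2).add (d1.const_mul 2)).add ((d0.pow 2).mul d3) |>.sub
        (d4.const_mul 3)
    refine (d5.congr_of_mem (f₁ := (freeMap u).fst) (fun y hy => ?_) hx').congr_deriv ?_
    · rw [freeMap_fst u hy, freeFst]
      rcases eq_or_lt_of_le hy.1 with h0 | h0
      · simp [← h0]
      · have hne : (y : ℂ) ≠ 0 := by exact_mod_cast h0.ne'
        rw [D]
        field_simp
    · simp only [Pi.neg_apply, Pi.pow_apply]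
      push_cast
      ring
  · have hx' := Ioc_subset_Icc_self hx
    have d0 := hasDerivWithinAt_ofReal x
    have d1 := hasDerivWithinAt_of_contDiffOn hv hx'
    have d2 := hasDerivWithinAt_of_contDiffOn u.1.snd_contDiffOn hx'
    have d3 := hasDerivWithinAt_of_contDiffOn (mod_cast smooth_le (smooth_deriv u.2.2.1) 1) hx'
    have d4 : HasDerivWithinAt (fun x : ℝ => -(x : ℂ) ^ 2 * D (D u.1.fst) x - u.1.snd x
      + (x : ℂ) * derivWithin u.1.snd I01 x) _ I01 x :=
      ((d0.pow 2).neg.mul d1).sub d2 |>.add (d0.mul d3)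
    refine d4.congr_deriv ?_
    simp only [Pi.neg_apply, Pi.pow_apply]
    push_cast
    ring

/-- In the variables `v = D² u₁`, `w = u₂'` the second component of the free operator is
`v' - 2 w - ρ w'`. -/
lemma derivWithin_freeMap_snd (u : smoothDomain) {ρ : ℝ} (hρ : ρ ∈ I01) :
    derivWithin (freeMap u).snd I01 ρ = derivWithin (D (D u.1.fst)) I01 ρ
      - 2 * derivWithin u.1.snd I01 ρ - (ρ : ℂ) * derivWithin (derivWithin u.1.snd I01) I01 ρ := by
  have d0 := hasDerivWithinAt_ofReal ρ
  have d1 := hasDerivWithinAt_of_contDiffOn (DD_contDiffOn u.2.1 u.2.2.2.1) hρ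
  have d2 := hasDerivWithinAt_of_contDiffOn u.1.snd_contDiffOn hρ
  have d3 := hasDerivWithinAt_of_contDiffOn (mod_cast smooth_le (smooth_deriv u.2.2.1) 1) hρ
  have d4 : HasDerivWithinAt (freeSnd u.1) _ I01 ρ := (d1.sub (d0.mul d3)).sub d2
  rw [derivWithin_congr (freeMap_snd u) (freeMap_snd u hρ), d4.derivWithin (uniq ρ hρ)]
  ring

lemma integral_congr_Ioc {E : Type*} [NormedAddCommGroup E] [NormedSpace ℝ E] {f g : ℝ → E}
    (h : ∀ ρ ∈ Ioc (0 : ℝ) 1, f ρ = g ρ) :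
    ∫ ρ in (0 : ℝ)..1, f ρ = ∫ ρ in (0 : ℝ)..1, g ρ := by
  rw [intervalIntegral.integral_of_le zero_le_one, intervalIntegral.integral_of_le zero_le_one]
  exact setIntegral_congr_fun measurableSet_Ioc h

lemma hasDerivWithinAt_re_mul_conj {f g : ℝ → ℂ} {f' g' : ℂ} {ρ : ℝ}
    (hf : HasDerivWithinAt f f' I01 ρ) (hg : HasDerivWithinAt g g' I01 ρ) :
    HasDerivWithinAt (fun x => (f x * conj (g x)).re) (f' * conj (g ρ) + f ρ * conj g').re I01 ρ :=
  (Complex.reCLM.hasFDerivAt.comp_hasDerivWithinAt ρ (hf.mul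
    ((Complex.conjCLE : ℂ →L[ℝ] ℂ).hasFDerivAt.comp_hasDerivWithinAt ρ hg)))

/-- The free operator is dissipative with constant `3/2`. In the variables `v = D² u₁`, `w = u₂'`
the integrand of `Re (u | L₀ u) + 3/2 ‖u‖²` is the derivative of
`Φ = -ρ (|v|² + |w|²) / 2 + Re (v w̄)`, and `Φ(0) = 0`, `Φ(1) = -|v(1) - w(1)|² / 2`. -/
lemma freeMap_dissipative (u : smoothDomain) :
    (inner ℂ u.1 (freeMap u)).re ≤ -(3 / 2) * ‖u.1‖ ^ 2 := by
  set v := D (D u.1.fst) with hv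
  set w := derivWithin u.1.snd I01 with hw
  have cv : ContDiffOn ℝ 1 v I01 := DD_contDiffOn u.2.1 u.2.2.2.1
  have cw : ContDiffOn ℝ 1 w I01 := mod_cast smooth_le (smooth_deriv u.2.2.1) 1
  have cv' : ContinuousOn (derivWithin v I01) I01 :=
    (cv.derivWithin uniq (m := 0) (by norm_num)).continuousOn
  have cw' : ContinuousOn (derivWithin w I01) I01 :=
    (cw.derivWithin uniq (m := 0) (by norm_num)).continuousOn
  have cid : ContinuousOn (fun x : ℝ => (x : ℂ)) I01 := Complex.continuous_ofReal.continuousOn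
  have conjc : ∀ {f : ℝ → ℂ}, ContinuousOn f I01 → ContinuousOn (fun x => conj (f x)) I01 :=
    fun h => Complex.continuous_conj.comp_continuousOn h
  have ii : ∀ {F : Type} [NormedAddCommGroup F] {f : ℝ → F}, ContinuousOn f I01 →
      IntervalIntegrable f volume 0 1 := fun h =>
    ContinuousOn.intervalIntegrable (by rwa [uIcc_of_le zero_le_one])
  let Φ : ℝ → ℝ := fun x => -x / 2 * ((v x * conj (v x)).re + (w x * conj (w x)).re)
    + (v x * conj (w x)).re
  let A : ℝ → ℂ := fun x => (-(x : ℂ) * derivWithin v I01 x - 2 * v x + derivWithin w I01 x)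
    * conj (v x)
  let B : ℝ → ℂ := fun x => (derivWithin v I01 x - 2 * w x - (x : ℂ) * derivWithin w I01 x)
    * conj (w x)
  let N : ℝ → ℝ := fun x => ‖v x‖ ^ 2 + ‖w x‖ ^ 2
  have cA : ContinuousOn A I01 := ((((cid.neg).mul cv').sub (continuousOn_const.mul
    cv.continuousOn)).add cw').mul (conjc cv.continuousOn)
  have cB : ContinuousOn B I01 := ((cv'.sub (continuousOn_const.mul
    cw.continuousOn)).sub (cid.mul cw')).mul (conjc cw.continuousOn)
  have hinner : inner ℂ u.1 (freeMap u) = (∫ ρ in (0 : ℝ)..1, A ρ) + ∫ ρ in (0 : ℝ)..1, B ρ := by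
    refine (PreH.inner_def u.1 (freeMap u)).trans ?_
    congr 1
    · exact integral_congr_Ioc fun ρ hρ => by rw [DD_freeMap u hρ]
    · exact integral_congr_Ioc fun ρ hρ => by
        rw [derivWithin_freeMap_snd u (Ioc_subset_Icc_self hρ)]
  have hnorm : ‖u.1‖ ^ 2 = ∫ ρ in (0 : ℝ)..1, N ρ := by
    rw [PreH.norm_sq_eq]
    exact (intervalIntegral.integral_add (ii (cv.continuousOn.norm.pow 2))
      (ii (cw.continuousOn.norm.pow 2))).symm
  have cN : ContinuousOn N I01 := (cv.continuousOn.norm.pow 2).add (cw.continuousOn.norm.pow 2)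
  have hΦ : ∀ x ∈ I01, HasDerivWithinAt Φ ((A x + B x).re + 3 / 2 * N x) I01 x := by
    intro x hx
    have dv := hasDerivWithinAt_of_contDiffOn cv hx
    have dw := hasDerivWithinAt_of_contDiffOn cw hx
    have d := (((hasDerivWithinAt_id x I01).neg.div_const 2).mul
      ((hasDerivWithinAt_re_mul_conj dv dv).add (hasDerivWithinAt_re_mul_conj dw dw))).add
      (hasDerivWithinAt_re_mul_conj dv dw)
    refine d.congr_deriv ?_
    simp only [A, B, N, ← Complex.normSq_eq_norm_sq, Complex.normSq_apply]
    simp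
    ring
  have hftc : ∫ ρ in (0 : ℝ)..1, ((A ρ + B ρ).re + 3 / 2 * N ρ) = Φ 1 - Φ 0 := by
    refine intervalIntegral.integral_eq_sub_of_hasDerivAt_of_le zero_le_one
      (fun x hx => (hΦ x hx).continuousWithinAt)
      (fun x hx => (hΦ x (Ioo_subset_Icc_self hx)).hasDerivAt (Icc_mem_nhds hx.1 hx.2)) ?_
    exact ii ((Complex.continuous_re.comp_continuousOn (cA.add cB)).add
      (continuousOn_const.mul cN))
  have hre : (∫ ρ in (0 : ℝ)..1, (A ρ + B ρ).re) = (inner ℂ u.1 (freeMap u)).re := by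
    rw [hinner, ← intervalIntegral.integral_add (ii cA) (ii cB)]
    exact Complex.reCLM.intervalIntegral_comp_comm (ii (cA.add cB))
  have cre : ContinuousOn (fun x => (A x + B x).re) I01 :=
    Complex.continuous_re.comp_continuousOn (cA.add cB)
  have cN' : ContinuousOn (fun x => 3 / 2 * N x) I01 := continuousOn_const.mul cN
  rw [intervalIntegral.integral_add (ii cre) (ii cN'), hre, intervalIntegral.integral_const_mul,
    ← hnorm] at hftc
  have h0 : Φ 0 = 0 := by
    have : v 0 = 0 := by simp [hv, D]
    simp [Φ, this]
  have h1 : Φ 1 ≤ 0 := by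
    have : Φ 1 = -(1 / 2) * Complex.normSq (v 1 - w 1) := by
      simp only [Φ, Complex.normSq_apply]
      simp
      ring
    rw [this]
    have := Complex.normSq_nonneg (v 1 - w 1)
    linarith
  linarith

/-! ### Elements with polynomial data are dense -/

lemma prim_hasDerivWithinAt {w : ℝ → ℂ} (hw : ContinuousOn w I01) {ρ : ℝ} (hρ : ρ ∈ I01) :
    HasDerivWithinAt (fun x => ∫ s in (0 : ℝ)..x, w s) (w ρ) I01 ρ := by
  have : Fact (ρ ∈ Icc (0 : ℝ) 1) := ⟨hρ⟩
  refine intervalIntegral.integral_hasDerivWithinAt_right (t := I01) ?_ ?_ (hw ρ hρ)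
  · apply ContinuousOn.intervalIntegrable
    rw [uIcc_of_le hρ.1]
    exact hw.mono (Icc_subset_Icc_right hρ.2)
  · exact hw.stronglyMeasurableAtFilter_nhdsWithin measurableSet_Icc ρ

lemma DD_zero (f : ℝ → ℂ) : D (D f) 0 = 0 := by simp [D]

/-- Every pair `(v, w)` of smooth functions with `v(0) = 0` is `(D² u₁, u₂')` for some `u` in the
smooth domain, namely for `u₁ = K² v` and the primitive `u₂` of `w` with `u₂(0) = 0`. -/
lemma exists_smoothDomain {v w : ℝ → ℂ} (hv : ContDiffOn ℝ ∞ v I01) (hw : ContDiffOn ℝ ∞ w I01)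
    (h0 : v 0 = 0) : ∃ u : smoothDomain, EqOn (D (D u.1.fst)) v I01 ∧
      EqOn (derivWithin u.1.snd I01) w I01 := by
  obtain ⟨C, hC0, hC⟩ := taylor_zero (n := 0) (mod_cast smooth_le hv 1)
    (fun k hk => by obtain rfl : k = 0 := (by omega); simpa using h0)
  have sKK := K_smooth (K_smooth hv)
  have vKK := vanish_of_bound (n := 4) sKK (K_bound hC0 (K_bound hC0 hC))
  let W : ℝ → ℂ := fun x => ∫ s in (0 : ℝ)..x, w s
  have hW : ∀ x ∈ I01, HasDerivWithinAt W (w x) I01 x :=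
    fun x hx => prim_hasDerivWithinAt hw.continuousOn hx
  have sW : ContDiffOn ℝ ∞ W I01 := by
    rw [contDiffOn_infty_iff_derivWithin uniq]
    exact ⟨fun x hx => (hW x hx).differentiableWithinAt,
      hw.congr fun x hx => (hW x hx).derivWithin (uniq x hx)⟩
  have hW0 : W 0 = 0 := by simp [W]
  let u : PreH := mkPreH (K (K v)) W (mod_cast smooth_le sKK 4) (mod_cast smooth_le sW 1)
    (fun k hk => vKK k (by omega)) hW0
  have e1 : EqOn u.fst (K (K v)) I01 := ext_restrict (K (K v))
  have e2 : EqOn u.snd W I01 := ext_restrict W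
  refine ⟨⟨u, sKK.congr e1, sW.congr e2, fun k hk =>
    (iteratedDerivWithin_congr e1 zero_mem).trans (vKK k hk), u.snd_zero⟩, fun x hx => ?_,
    fun x hx => ?_⟩
  · rcases eq_or_lt_of_le hx.1 with hx0 | hx0
    · rw [← hx0, DD_zero, h0]
    · refine DD_of_hasDerivWithinAt (p := K v) (fun y hy => ?_) (fun y hy => ?_) x ⟨hx0, hx.2⟩
      · have hy' := Ioc_subset_Icc_self hy
        exact (K_hasDeriv (K_smooth hv).continuousOn hy').congr_of_mem e1 hy'
      · exact K_hasDeriv hv.continuousOn (Ioc_subset_Icc_self hy)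
  · exact ((hW x hx).congr_of_mem e2 hx).derivWithin (uniq x hx)

lemma PreH.DD_sub (u v : PreH) {ρ : ℝ} (hρ : ρ ∈ I01) :
    D (D (u - v).fst) ρ = D (D u.fst) ρ - D (D v.fst) ρ := by
  have h : u - v = u + (-1 : ℂ) • v := by module
  have h2 := DD_add (u.fst_contDiffOn.of_le (by norm_num))
    (((-1 : ℂ) • v).fst_contDiffOn.of_le (by norm_num)) hρ
  rw [h, PreH.fst_add, h2, PreH.fst_smul, Pi.add_apply, DD_smul]
  simp [sub_eq_add_neg]

lemma PreH.derivWithin_snd_sub (u v : PreH) {ρ : ℝ} (hρ : ρ ∈ I01) :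
    derivWithin (u - v).snd I01 ρ = derivWithin u.snd I01 ρ - derivWithin v.snd I01 ρ :=
  derivWithin_sub (u.snd_contDiffOn.differentiableOn (by norm_num) ρ hρ)
    (v.snd_contDiffOn.differentiableOn (by norm_num) ρ hρ)

lemma norm_sub_sq_le_three (a b c d : ℂ) :
    ‖a - d‖ ^ 2 ≤ 3 * (‖a - b‖ ^ 2 + ‖b - c‖ ^ 2 + ‖c - d‖ ^ 2) := by
  have h : ‖a - d‖ ≤ ‖a - b‖ + ‖b - c‖ + ‖c - d‖ := by
    have : a - d = a - b + (b - c) + (c - d) := by ring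
    rw [this]
    exact norm_add₃_le
  have := norm_nonneg (a - d)
  nlinarith [sq_nonneg (‖a - b‖ - ‖b - c‖), sq_nonneg (‖a - b‖ - ‖c - d‖),
    sq_nonneg (‖b - c‖ - ‖c - d‖)]

lemma exists_complex_polynomial_near {g : ℝ → ℂ} (hg : ContinuousOn g I01) {ε : ℝ} (hε : 0 < ε) :
    ∃ P : Polynomial ℂ, ∀ x ∈ I01, ‖g x - P.eval (x : ℂ)‖ ≤ ε := by
  obtain ⟨p, hp⟩ := exists_polynomial_near_of_continuousOn 0 1 (fun x => (g x).re)
    (Complex.continuous_re.comp_continuousOn hg) (ε / 2) (by positivity)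
  obtain ⟨q, hq⟩ := exists_polynomial_near_of_continuousOn 0 1 (fun x => (g x).im)
    (Complex.continuous_im.comp_continuousOn hg) (ε / 2) (by positivity)
  refine ⟨p.map (algebraMap ℝ ℂ) + Polynomial.C Complex.I * q.map (algebraMap ℝ ℂ),
    fun x hx => ?_⟩
  have ev : ∀ r : Polynomial ℝ, (r.map (algebraMap ℝ ℂ)).eval (x : ℂ) = ((r.eval x : ℝ) : ℂ) :=
    fun r => by
      rw [Polynomial.eval_map, ← Complex.coe_algebraMap, Polynomial.eval₂_at_apply]
  rw [Polynomial.eval_add, Polynomial.eval_mul, Polynomial.eval_C, ev, ev]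
  refine (Complex.norm_le_abs_re_add_abs_im _).trans ?_
  have h1 := hp x hx
  have h2 := hq x hx
  rw [abs_sub_comm] at h1 h2
  simp
  linarith

/-- Polynomials that vanish at `0` are dense in `L²(0,1)`: a polynomial `P` is corrected to
`P - P(0) (1 - X)^n`, which changes it by at most `|P(0)|² / (2 n + 1)` in the square of the
norm. -/
lemma exists_polynomial_integral_sq_lt {f : ℝ → ℂ} (hf : MemLp f 2 (volume.restrict (Ioc 0 1)))
    {δ : ℝ} (hδ : 0 < δ) : ∃ P : Polynomial ℂ, P.eval 0 = 0 ∧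
      ∫ ρ in (0 : ℝ)..1, ‖f ρ - P.eval (ρ : ℂ)‖ ^ 2 < δ := by
  obtain ⟨g, hg, gm⟩ := MemLp.exists_boundedContinuous_integral_rpow_sub_le
    (μ := volume.restrict (Ioc (0 : ℝ) 1)) (f := f) (p := 2) (by norm_num) (by simpa using hf)
    (ε := δ / 12) (by positivity)
  have hg' : ∫ ρ in (0 : ℝ)..1, ‖f ρ - g ρ‖ ^ 2 ≤ δ / 12 := by
    rw [intervalIntegral.integral_of_le zero_le_one]
    simpa using hg
  obtain ⟨P, hP⟩ := exists_complex_polynomial_near (g := g) g.continuous.continuousOn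
    (ε := √(δ / 12)) (by positivity)
  set a := P.eval 0 with ha
  obtain ⟨n, hn⟩ := exists_nat_gt (‖a‖ ^ 2 / (δ / 12))
  let Q : Polynomial ℂ := P - Polynomial.C a * (1 - Polynomial.X) ^ n
  have hQ : ∀ x : ℝ, P.eval (x : ℂ) - Q.eval (x : ℂ) = a * (1 - (x : ℂ)) ^ n := by
    intro x
    simp [Q]
  have i1 : IntervalIntegrable (fun ρ => ‖f ρ - g ρ‖ ^ 2) volume 0 1 := by
    rw [intervalIntegrable_iff_integrableOn_Ioc_of_le zero_le_one]
    exact (hf.sub (by simpa using gm)).integrable_norm_pow (p := 2) (by norm_num)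
  have i2 : IntervalIntegrable (fun ρ => ‖g ρ - P.eval (ρ : ℂ)‖ ^ 2) volume 0 1 :=
    Continuous.intervalIntegrable (by fun_prop) _ _
  have i3 : IntervalIntegrable (fun ρ : ℝ => ‖P.eval (ρ : ℂ) - Q.eval (ρ : ℂ)‖ ^ 2) volume 0 1 :=
    Continuous.intervalIntegrable (by fun_prop) _ _
  have h2 : ∫ ρ in (0 : ℝ)..1, ‖g ρ - P.eval (ρ : ℂ)‖ ^ 2 ≤ δ / 12 := by
    have := intervalIntegral.integral_mono_on zero_le_one i2
      (intervalIntegrable_const (c := δ / 12)) fun x hx => by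
        have h := pow_le_pow_left₀ (norm_nonneg _) (hP x hx) 2
        rwa [Real.sq_sqrt (by positivity)] at h
    simpa using this
  have h3 : ∫ ρ in (0 : ℝ)..1, ‖P.eval (ρ : ℂ) - Q.eval (ρ : ℂ)‖ ^ 2 ≤ δ / 12 := by
    have e : ∀ ρ ∈ uIcc (0 : ℝ) 1, ‖P.eval (ρ : ℂ) - Q.eval (ρ : ℂ)‖ ^ 2
        = ‖a‖ ^ 2 * (1 - ρ) ^ (2 * n) := by
      intro ρ _
      rw [hQ, norm_mul, norm_pow, ← Complex.ofReal_one, ← Complex.ofReal_sub, Complex.norm_real,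
        mul_pow, ← pow_mul, mul_comm n 2, pow_mul ‖1 - ρ‖, Real.norm_eq_abs, sq_abs, pow_mul]
    have e2 : ∫ ρ in (0 : ℝ)..1, (1 - ρ) ^ (2 * n) = 1 / (2 * n + 1) := by
      rw [intervalIntegral.integral_comp_sub_left (fun x : ℝ => x ^ (2 * n)) 1]
      simp
    rw [intervalIntegral.integral_congr e, intervalIntegral.integral_const_mul, e2,
      mul_one_div, div_le_iff₀ (by positivity)]
    rw [div_lt_iff₀ (by positivity)] at hn
    have : (0 : ℝ) ≤ n := n.cast_nonneg
    nlinarith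
  have i4 : IntervalIntegrable (fun ρ => ‖f ρ - Q.eval (ρ : ℂ)‖ ^ 2) volume 0 1 := by
    rw [intervalIntegrable_iff_integrableOn_Ioc_of_le zero_le_one]
    have hm : MemLp (fun ρ : ℝ => Q.eval (ρ : ℂ)) 2 (volume.restrict (Ioc (0 : ℝ) 1)) := by
      have hc : Continuous fun ρ : ℝ => Q.eval (ρ : ℂ) := by fun_prop
      obtain ⟨M, hM⟩ := isCompact_Icc.exists_bound_of_continuousOn
        (hc.continuousOn (s := I01))
      refine MemLp.of_bound hc.aestronglyMeasurable M ?_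
      filter_upwards [ae_restrict_mem measurableSet_Ioc] with x hx
      exact hM x (Ioc_subset_Icc_self hx)
    exact (hf.sub hm).integrable_norm_pow (p := 2) (by norm_num)
  refine ⟨Q, by simp [Q, ← ha], ?_⟩
  have := intervalIntegral.integral_mono_on zero_le_one i4 (((i1.add i2).add i3).const_mul 3)
    fun x _ => norm_sub_sq_le_three (f x) (g x) (P.eval (x : ℂ)) (Q.eval (x : ℂ))
  have e : ∫ ρ in (0 : ℝ)..1, 3 * (‖f ρ - g ρ‖ ^ 2 + ‖g ρ - P.eval (ρ : ℂ)‖ ^ 2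
      + ‖P.eval (ρ : ℂ) - Q.eval (ρ : ℂ)‖ ^ 2) = 3 * ((∫ ρ in (0 : ℝ)..1, ‖f ρ - g ρ‖ ^ 2)
      + (∫ ρ in (0 : ℝ)..1, ‖g ρ - P.eval (ρ : ℂ)‖ ^ 2)
      + ∫ ρ in (0 : ℝ)..1, ‖P.eval (ρ : ℂ) - Q.eval (ρ : ℂ)‖ ^ 2) := by
    rw [intervalIntegral.integral_const_mul, intervalIntegral.integral_add (i1.add i2) i3,
      intervalIntegral.integral_add i1 i2]
  have h4 := this.trans_eq e
  linarith

/-- A set of elements of `H̃` that realizes all pairs of polynomials `(G, W)` with `G(0) = 0` as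
`(D² u₁, u₂')` is dense. -/
lemma dense_of_polynomial_data {S : Set PreH}
    (hS : ∀ G W : Polynomial ℂ, G.eval 0 = 0 → ∃ y ∈ S, ∀ ρ ∈ Ioc (0 : ℝ) 1,
      D (D y.fst) ρ = G.eval (ρ : ℂ) ∧ derivWithin y.snd I01 ρ = W.eval (ρ : ℂ)) : Dense S := by
  rw [Metric.dense_iff]
  intro x δ hδ
  have m1 : MemLp (D (D x.fst)) 2 (volume.restrict (Ioc 0 1)) := by
    obtain ⟨C, hC⟩ := DD_bound x.fst_contDiffOn x.fst_vanish
    refine MemLp.of_bound (x.DD_continuousOn.aestronglyMeasurable measurableSet_Ioc) C ?_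
    filter_upwards [ae_restrict_mem measurableSet_Ioc] with ρ hρ
    exact hC ρ (Ioc_subset_Icc_self hρ)
  have m2 : MemLp (derivWithin x.snd I01) 2 (volume.restrict (Ioc 0 1)) := by
    obtain ⟨C, hC⟩ := isCompact_Icc.exists_bound_of_continuousOn x.snd_deriv_continuousOn
    refine MemLp.of_bound ((x.snd_deriv_continuousOn.mono
      Ioc_subset_Icc_self).aestronglyMeasurable measurableSet_Ioc) C ?_
    filter_upwards [ae_restrict_mem measurableSet_Ioc] with ρ hρ
    exact hC ρ (Ioc_subset_Icc_self hρ)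
  obtain ⟨G, hG0, hG⟩ := exists_polynomial_integral_sq_lt m1 (δ := δ ^ 2 / 2) (by positivity)
  obtain ⟨W, -, hW⟩ := exists_polynomial_integral_sq_lt m2 (δ := δ ^ 2 / 2) (by positivity)
  obtain ⟨y, hyS, hy⟩ := hS G W hG0
  refine ⟨y, ?_, hyS⟩
  rw [Metric.mem_ball, dist_comm, dist_eq_norm]
  refine lt_of_pow_lt_pow_left₀ 2 hδ.le ?_
  rw [PreH.norm_sq_eq]
  have e1 : ∫ ρ in (0 : ℝ)..1, ‖D (D (x - y).fst) ρ‖ ^ 2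
      = ∫ ρ in (0 : ℝ)..1, ‖D (D x.fst) ρ - G.eval (ρ : ℂ)‖ ^ 2 :=
    integral_congr_Ioc fun ρ hρ => by
      rw [PreH.DD_sub _ _ (Ioc_subset_Icc_self hρ), (hy ρ hρ).1]
  have e2 : ∫ ρ in (0 : ℝ)..1, ‖derivWithin (x - y).snd I01 ρ‖ ^ 2
      = ∫ ρ in (0 : ℝ)..1, ‖derivWithin x.snd I01 ρ - W.eval (ρ : ℂ)‖ ^ 2 :=
    integral_congr_Ioc fun ρ hρ => by
      rw [PreH.derivWithin_snd_sub _ _ (Ioc_subset_Icc_self hρ), (hy ρ hρ).2]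
  rw [e1, e2]
  linarith

lemma smooth_polynomial (P : Polynomial ℂ) : ContDiffOn ℝ ∞ (fun ρ : ℝ => P.eval (ρ : ℂ)) I01 :=
  (P.differentiable.contDiff.restrict_scalars ℝ).comp_contDiffOn smooth_id

lemma denseRange_emb : DenseRange emb := UniformSpace.Completion.denseRange_coe

lemma continuous_emb : Continuous emb := UniformSpace.Completion.continuous_coe _

lemma norm_emb (u : PreH) : ‖emb u‖ = ‖u‖ := UniformSpace.Completion.norm_coe u

lemma denseRange_embDomain : DenseRange embDomain := by
  have h : DenseRange fun u : smoothDomain => u.1 :=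
    dense_of_polynomial_data fun G W hG => by
      obtain ⟨u, h1, h2⟩ := exists_smoothDomain (smooth_polynomial G) (smooth_polynomial W)
        (by simpa using hG)
      exact ⟨u.1, ⟨u, rfl⟩, fun ρ hρ =>
        ⟨h1 (Ioc_subset_Icc_self hρ), h2 (Ioc_subset_Icc_self hρ)⟩⟩
  exact denseRange_emb.comp h continuous_emb

/-! ### The range of `z - L₀` -/

/-- The Euler-type equation `μ Q + (X + c) Q' = P` is solvable in polynomials, unless `-μ` is a
natural number. -/
lemma exists_polynomial_euler {μ : ℂ} (hμ : ∀ n : ℕ, μ + n ≠ 0) (c : ℂ) (P : Polynomial ℂ) :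
    ∃ Q : Polynomial ℂ, Polynomial.C μ * Q
      + (Polynomial.X + Polynomial.C c) * Polynomial.derivative Q = P := by
  have h0 : ∀ P : Polynomial ℂ, ∃ Q : Polynomial ℂ, Polynomial.C μ * Q
      + Polynomial.X * Polynomial.derivative Q = P := by
    intro P
    induction P using Polynomial.induction_on' with
    | add p q hp hq =>
      obtain ⟨p', rfl⟩ := hp
      obtain ⟨q', rfl⟩ := hq
      exact ⟨p' + q', by rw [Polynomial.derivative_add]; ring⟩
    | monomial n a =>
      refine ⟨Polynomial.monomial n (a / (μ + n)), ?_⟩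
      rw [Polynomial.derivative_monomial, Polynomial.C_mul_monomial]
      rcases n with _ | n
      · have := hμ 0
        simp at this ⊢
        rw [← Polynomial.C_mul, mul_div_cancel₀ _ this]
      · rw [Polynomial.X_mul_monomial, Nat.add_sub_cancel, ← map_add]
        congr 1
        have := hμ (n + 1)
        push_cast at this ⊢
        field_simp
  obtain ⟨Q, hQ⟩ := h0 (P.comp (Polynomial.X - Polynomial.C c))
  refine ⟨Q.comp (Polynomial.X + Polynomial.C c), ?_⟩
  have := congrArg (fun R => R.comp (Polynomial.X + Polynomial.C c)) hQ
  simpa [Polynomial.derivative_comp, Polynomial.comp_assoc] using this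

/-- For polynomials `G`, `W` and `Re z > -2` the equation `(z - L₀) u = f` with data
`(D² f₁, f₂') = (G, W)` has a solution in the smooth domain. The sum and the difference of
`v = D² u₁` and `w = u₂'` satisfy decoupled equations with polynomial solutions; adding a multiple
of the solution `(1 + ρ)^(-z-2)` of the homogeneous equation for `v - w`, which is smooth on
`[0,1]`, achieves `v(0) = 0`. -/
lemma exists_solution_polynomial {z : ℂ} (hz : -2 < z.re) (G W : Polynomial ℂ) :
    ∃ u : smoothDomain, ∀ ρ ∈ Ioc (0 : ℝ) 1,
      D (D (z • u.1 - freeMap u).fst) ρ = G.eval (ρ : ℂ) ∧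
      derivWithin (z • u.1 - freeMap u).snd I01 ρ = W.eval (ρ : ℂ) := by
  have hμ : ∀ n : ℕ, z + 2 + n ≠ 0 := by
    intro n h
    have := congrArg Complex.re h
    simp at this
    have hn : (0 : ℝ) ≤ n := n.cast_nonneg
    linarith
  obtain ⟨P, hP⟩ := exists_polynomial_euler hμ (-1) (G + W)
  obtain ⟨Q, hQ⟩ := exists_polynomial_euler hμ 1 (G - W)
  let E : ℝ → ℂ := fun x => Complex.exp (-(z + 2) * (Real.log (1 + x) : ℝ))
  have dE : ∀ x ∈ I01, HasDerivWithinAt E (-(z + 2) / (1 + x) * E x) I01 x := by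
    intro x hx
    have hpos : 0 < 1 + x := by linarith [hx.1]
    have d1 : HasDerivAt (fun x : ℝ => Real.log (1 + x)) (1 / (1 + x)) x :=
      ((hasDerivAt_id x).const_add 1).log hpos.ne'
    have d2 := ((d1.ofReal_comp.const_mul (-(z + 2))).cexp).hasDerivWithinAt (s := I01)
    refine d2.congr_deriv ?_
    simp only [E]
    push_cast
    ring
  have sE : ContDiffOn ℝ ∞ E I01 := by
    have h1 : ContDiffOn ℝ ∞ (fun x : ℝ => Real.log (1 + x)) I01 :=
      (contDiffOn_const.add contDiffOn_id).log fun x hx => by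
        have := hx.1
        simp only [id]
        positivity
    exact (contDiffOn_const.mul (Complex.ofRealCLM.contDiff.comp_contDiffOn h1)).cexp
  let c : ℂ := -(P.eval 0 + Q.eval 0)
  let v : ℝ → ℂ := fun x => (P.eval (x : ℂ) + (Q.eval (x : ℂ) + c * E x)) / 2
  let w : ℝ → ℂ := fun x => (P.eval (x : ℂ) - (Q.eval (x : ℂ) + c * E x)) / 2
  have sP := smooth_polynomial P
  have sQ := (smooth_polynomial Q).add (contDiffOn_const (c := c) |>.mul sE)
  obtain ⟨u, h1, h2⟩ := exists_smoothDomain (v := v) (w := w) ((sP.add sQ).div_const 2)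
    ((sP.sub sQ).div_const 2) (by simp [v, c, E])
  refine ⟨u, fun ρ hρ => ?_⟩
  have hρ' := Ioc_subset_Icc_self hρ
  have dpoly : ∀ R : Polynomial ℂ, HasDerivWithinAt (fun x : ℝ => R.eval (x : ℂ))
      (R.derivative.eval (ρ : ℂ)) I01 ρ := fun R =>
    ((R.hasDerivAt (ρ : ℂ)).comp_ofReal).hasDerivWithinAt
  have dQ := (dpoly Q).add ((dE ρ hρ').const_mul c)
  have dv : derivWithin (D (D u.1.fst)) I01 ρ = _ :=
    ((((dpoly P).add dQ).div_const 2).congr_of_mem h1 hρ').derivWithin (uniq ρ hρ')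
  have dw : derivWithin (derivWithin u.1.snd I01) I01 ρ = _ :=
    ((((dpoly P).sub dQ).div_const 2).congr_of_mem h2 hρ').derivWithin (uniq ρ hρ')
  have eP := congrArg (Polynomial.eval (ρ : ℂ)) hP
  have eQ := congrArg (Polynomial.eval (ρ : ℂ)) hQ
  simp only [Polynomial.eval_add, Polynomial.eval_sub, Polynomial.eval_mul, Polynomial.eval_C,
    Polynomial.eval_X] at eP eQ
  have hne : (1 : ℂ) + ρ ≠ 0 := by
    have : (1 : ℝ) + ρ ≠ 0 := by linarith [hρ.1]
    exact_mod_cast this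
  have hE : (1 + (ρ : ℂ)) * (-(z + 2) / (1 + ρ) * E ρ) = -(z + 2) * E ρ := by
    field_simp
  constructor
  · rw [PreH.DD_sub _ _ hρ', PreH.fst_smul, DD_smul, Pi.smul_apply, DD_freeMap u hρ, dv, dw,
      h1 hρ', smul_eq_mul]
    simp only [v]
    linear_combination (eP + eQ) / 2 + c / 2 * hE
  · rw [PreH.derivWithin_snd_sub _ _ hρ', PreH.snd_smul, derivWithin_const_smul_field,
      derivWithin_freeMap_snd u hρ', dv, dw, h2 hρ', smul_eq_mul]
    simp only [w]
    linear_combination (eP - eQ) / 2 - c / 2 * hE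

lemma denseRange_sub_freeMap {z : ℂ} (hz : -2 < z.re) :
    DenseRange fun u : smoothDomain => emb (z • u.1 - freeMap u) := by
  have h : DenseRange fun u : smoothDomain => z • u.1 - freeMap u :=
    dense_of_polynomial_data fun G W _ => by
      obtain ⟨u, hu⟩ := exists_solution_polynomial hz G W
      exact ⟨_, ⟨u, rfl⟩, hu⟩
  exact denseRange_emb.comp h continuous_emb

/-! ### The potential term -/

lemma intervalIntegrable_of_continuousOn_I01 {F : Type*} [NormedAddCommGroup F] {f : ℝ → F}
    (hf : ContinuousOn f I01) : IntervalIntegrable f volume 0 1 :=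
  ContinuousOn.intervalIntegrable (by rwa [uIcc_of_le zero_le_one])

/-- Jensen's inequality on the unit interval. -/
lemma sq_integral_norm_le {f : ℝ → ℂ} (hf : ContinuousOn f I01) :
    (∫ ρ in (0 : ℝ)..1, ‖f ρ‖) ^ 2 ≤ ∫ ρ in (0 : ℝ)..1, ‖f ρ‖ ^ 2 := by
  set N := ∫ ρ in (0 : ℝ)..1, ‖f ρ‖ with hN
  have i1 : IntervalIntegrable (fun ρ => 2 * N * ‖f ρ‖) volume 0 1 :=
    intervalIntegrable_of_continuousOn_I01 (continuousOn_const.mul hf.norm)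
  have i2 : IntervalIntegrable (fun ρ => ‖f ρ‖ ^ 2) volume 0 1 :=
    intervalIntegrable_of_continuousOn_I01 (hf.norm.pow 2)
  have h := intervalIntegral.integral_mono_on zero_le_one i1
    (i2.add (intervalIntegrable_const (c := N ^ 2)))
    fun x _ => by nlinarith [sq_nonneg (‖f x‖ - N)]
  rw [intervalIntegral.integral_const_mul, ← hN, intervalIntegral.integral_add i2
    intervalIntegrable_const, intervalIntegral.integral_const] at h
  simp only [sub_zero, one_smul] at h
  linarith

lemma norm_integral_le_integral_norm_I01 {f : ℝ → ℂ} (hf : ContinuousOn f I01) {x : ℝ}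
    (hx : x ∈ I01) : ‖∫ s in (0 : ℝ)..x, f s‖ ≤ ∫ s in (0 : ℝ)..1, ‖f s‖ :=
  (intervalIntegral.norm_integral_le_integral_norm hx.1).trans
    (intervalIntegral.integral_mono_interval le_rfl hx.1 hx.2 (.of_forall fun _ => norm_nonneg _)
      (intervalIntegrable_of_continuousOn_I01 hf.norm))

lemma norm_K_le {f : ℝ → ℂ} (hf : ContinuousOn f I01) {x : ℝ} (hx : x ∈ I01) :
    ‖K f x‖ ≤ (∫ s in (0 : ℝ)..1, ‖f s‖) * x := by
  have hsub : Icc (0 : ℝ) x ⊆ I01 := Icc_subset_Icc_right hx.2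
  have hc : ContinuousOn (fun s : ℝ => (s : ℂ) * f s) I01 :=
    Complex.continuous_ofReal.continuousOn.mul hf
  have ii : ∀ {g : ℝ → ℝ}, ContinuousOn g I01 → IntervalIntegrable g volume 0 x := fun hg =>
    ContinuousOn.intervalIntegrable (by rw [uIcc_of_le hx.1]; exact hg.mono hsub)
  calc ‖K f x‖ ≤ ∫ s in (0 : ℝ)..x, ‖(s : ℂ) * f s‖ :=
        intervalIntegral.norm_integral_le_integral_norm hx.1
    _ ≤ ∫ s in (0 : ℝ)..x, x * ‖f s‖ := by
        refine intervalIntegral.integral_mono_on hx.1 (ii hc.norm)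
          (ii (continuousOn_const.mul hf.norm)) fun s hs => ?_
        rw [norm_mul, Complex.norm_of_nonneg hs.1]
        exact mul_le_mul_of_nonneg_right hs.2 (norm_nonneg _)
    _ = x * ∫ s in (0 : ℝ)..x, ‖f s‖ := intervalIntegral.integral_const_mul _ _
    _ ≤ x * ∫ s in (0 : ℝ)..1, ‖f s‖ :=
        mul_le_mul_of_nonneg_left (intervalIntegral.integral_mono_interval le_rfl hx.1 hx.2
          (.of_forall fun _ => norm_nonneg _) (intervalIntegrable_of_continuousOn_I01 hf.norm)) hx.1
    _ = _ := mul_comm _ _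

/-- The Poincaré inequality `‖u₂‖ ≤ ‖u₂'‖` in `L²(0,1)`, from `u₂(0) = 0`. -/
lemma PreH.integral_snd_sq_le (u : PreH) :
    ∫ ρ in (0 : ℝ)..1, ‖u.snd ρ‖ ^ 2 ≤ ‖u‖ ^ 2 := by
  have hc := u.snd_deriv_continuousOn
  have hb : ∀ x ∈ I01, ‖u.snd x‖ ^ 2 ≤ ∫ ρ in (0 : ℝ)..1, ‖derivWithin u.snd I01 ρ‖ ^ 2 := by
    intro x hx
    have hftc : ∫ s in (0 : ℝ)..x, derivWithin u.snd I01 s = u.snd x - u.snd 0 := by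
      refine intervalIntegral.integral_eq_sub_of_hasDerivAt_of_le hx.1
        (u.snd_contDiffOn.continuousOn.mono (Icc_subset_Icc_right hx.2)) (fun y hy => ?_) ?_
      · exact (hasDerivWithinAt_of_contDiffOn u.snd_contDiffOn
          ⟨hy.1.le, hy.2.le.trans hx.2⟩).hasDerivAt (Icc_mem_nhds hy.1 (hy.2.trans_le hx.2))
      · apply ContinuousOn.intervalIntegrable
        rw [uIcc_of_le hx.1]
        exact hc.mono (Icc_subset_Icc_right hx.2)
    rw [u.snd_zero, sub_zero] at hftc
    rw [← hftc]
    exact (pow_le_pow_left₀ (norm_nonneg _) (norm_integral_le_integral_norm_I01 hc hx) 2).trans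
      (sq_integral_norm_le hc)
  have h1 := intervalIntegral.integral_mono_on zero_le_one
    (intervalIntegrable_of_continuousOn_I01 (u.snd_contDiffOn.continuousOn.norm.pow 2))
    intervalIntegrable_const hb
  have h2 : 0 ≤ ∫ ρ in (0 : ℝ)..1, ‖D (D u.fst) ρ‖ ^ 2 :=
    intervalIntegral.integral_nonneg zero_le_one fun _ _ => by positivity
  rw [PreH.norm_sq_eq]
  simp only [intervalIntegral.integral_const, sub_zero, one_smul] at h1
  exact h1.trans (by linarith)

lemma potMap_fst (V : ℝ → ℝ) (hV : ContDiffOn ℝ ∞ V I01) (u : smoothDomain) :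
    EqOn (potMap V hV u).fst (potFst V u) I01 :=
  ext_restrict (potFst V u)

/-- The potential term depends on `u₂` only through its `L²` norm: in
`D² (V K² u₂)` the operator `D²` cancels the two integrations `K`, and the terms in which
derivatives fall on `V` are controlled by `K u₂ = O(ρ)` and `K² u₂ = O(ρ³)`. -/
lemma exists_norm_potMap_le (V : ℝ → ℝ) (hV : ContDiffOn ℝ ∞ V I01) :
    ∃ M : ℝ, 0 ≤ M ∧ ∀ u : smoothDomain,
      ‖potMap V hV u‖ ^ 2 ≤ M * ∫ ρ in (0 : ℝ)..1, ‖u.1.snd ρ‖ ^ 2 := by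
  set U : ℝ → ℂ := fun ρ => (V ρ : ℂ) with hU
  have sU : ContDiffOn ℝ ∞ U I01 := smooth_ofReal hV
  have sU1 := smooth_deriv sU
  have sU2 := smooth_deriv sU1
  obtain ⟨M0, hM0⟩ := isCompact_Icc.exists_bound_of_continuousOn sU.continuousOn
  obtain ⟨M1, hM1⟩ := isCompact_Icc.exists_bound_of_continuousOn sU1.continuousOn
  obtain ⟨M2, hM2⟩ := isCompact_Icc.exists_bound_of_continuousOn sU2.continuousOn
  have p0 := (norm_nonneg _).trans (hM0 0 zero_mem)
  have p1 := (norm_nonneg _).trans (hM1 0 zero_mem)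
  have p2 := (norm_nonneg _).trans (hM2 0 zero_mem)
  set A := M2 + 3 * M1
  refine ⟨2 * (A ^ 2 + M0 ^ 2), by positivity, fun u => ?_⟩
  have sf := u.2.2.1
  have cf : ContinuousOn u.1.snd I01 := sf.continuousOn
  set f := u.1.snd with hf
  set N := ∫ s in (0 : ℝ)..1, ‖f s‖ with hN
  have N0 : 0 ≤ N := intervalIntegral.integral_nonneg zero_le_one fun _ _ => norm_nonneg _
  have sK := K_smooth sf
  have hq : ∀ x ∈ I01, ‖K f x‖ ≤ N * x := fun x hx => norm_K_le cf hx
  have hr : ∀ x ∈ I01, ‖K (K f) x‖ ≤ N * x ^ 3 :=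
    K_bound (n := 1) N0 fun x hx => by simpa using hq x hx
  have hDD : ∀ ρ ∈ Ioc (0 : ℝ) 1, D (D (potMap V hV u).fst) ρ
      = -derivWithin (derivWithin U I01) I01 ρ * K (K f) ρ / (ρ : ℂ) ^ 2
        + derivWithin U I01 ρ * K (K f) ρ / (ρ : ℂ) ^ 3
        - 2 * derivWithin U I01 ρ * K f ρ / (ρ : ℂ) - U ρ * f ρ := by
    refine DD_of_hasDerivWithinAt
      (p := fun x => -(derivWithin U I01 x * K (K f) x / (x : ℂ)) - U x * K f x)
      (fun x hx => ?_) (fun x hx => ?_)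
    all_goals
      have hx' := Ioc_subset_Icc_self hx
      have hne : (x : ℂ) ≠ 0 := by exact_mod_cast hx.1.ne'
      have d0 := hasDerivWithinAt_ofReal x
      have d1 := hasDerivWithinAt_of_contDiffOn (mod_cast smooth_le sU 1) hx'
      have d2 := hasDerivWithinAt_of_contDiffOn (mod_cast smooth_le sU1 1) hx'
      have d3 := K_hasDeriv cf hx'
      have d4 := K_hasDeriv sK.continuousOn hx'
    · have d5 : HasDerivWithinAt (fun x : ℝ => -U x * K (K f) x) _ I01 x := d1.neg.mul d4
      refine (d5.congr_of_mem (f₁ := (potMap V hV u).fst) (fun y hy => potMap_fst V hV u hy)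
        hx').congr_deriv ?_
      simp only [Pi.neg_apply]
      field_simp
      ring
    · have d5 : HasDerivWithinAt (fun x : ℝ => -(derivWithin U I01 x * K (K f) x / (x : ℂ))
          - U x * K f x) _ I01 x := ((d2.mul d4).div d0 hne).neg.sub (d1.mul d3)
      refine d5.congr_deriv ?_
      simp only [Pi.mul_apply]
      field_simp
      ring
  have hb : ∀ ρ ∈ Ioc (0 : ℝ) 1,
      ‖D (D (potMap V hV u).fst) ρ‖ ^ 2 ≤ 2 * (A ^ 2 * N ^ 2 + M0 ^ 2 * ‖f ρ‖ ^ 2) := by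
    intro ρ hρ
    have hρ' := Ioc_subset_Icc_self hρ
    have h0 := hρ.1
    have q := hq ρ hρ'
    have r := hr ρ hρ'
    have t1 : ‖-derivWithin (derivWithin U I01) I01 ρ * K (K f) ρ / (ρ : ℂ) ^ 2‖ ≤ M2 * N := by
      rw [norm_div, norm_mul, norm_neg, norm_pow, Complex.norm_of_nonneg h0.le,
        div_le_iff₀ (by positivity), mul_assoc]
      refine mul_le_mul (hM2 ρ hρ') (r.trans ?_) (norm_nonneg _) p2
      exact mul_le_mul_of_nonneg_left (pow_le_pow_of_le_one h0.le hρ.2 (by norm_num)) N0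
    have t2 : ‖derivWithin U I01 ρ * K (K f) ρ / (ρ : ℂ) ^ 3‖ ≤ M1 * N := by
      rw [norm_div, norm_mul, norm_pow, Complex.norm_of_nonneg h0.le,
        div_le_iff₀ (by positivity), mul_assoc]
      exact mul_le_mul (hM1 ρ hρ') r (norm_nonneg _) p1
    have t3 : ‖2 * derivWithin U I01 ρ * K f ρ / (ρ : ℂ)‖ ≤ 2 * M1 * N := by
      rw [norm_div, norm_mul, norm_mul, Complex.norm_of_nonneg h0.le, Complex.norm_ofNat,
        div_le_iff₀ h0, mul_assoc (2 * M1)]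
      exact mul_le_mul (mul_le_mul_of_nonneg_left (hM1 ρ hρ') (by norm_num)) q (norm_nonneg _)
        (by positivity)
    have t4 : ‖U ρ * f ρ‖ ≤ M0 * ‖f ρ‖ := by
      rw [norm_mul]
      exact mul_le_mul_of_nonneg_right (hM0 ρ hρ') (norm_nonneg _)
    have h : ‖D (D (potMap V hV u).fst) ρ‖ ≤ A * N + M0 * ‖f ρ‖ := by
      rw [hDD ρ hρ]
      refine (norm_sub_le _ _).trans ((add_le_add (norm_sub_le _ _) le_rfl).trans ?_)
      have := norm_add_le (-derivWithin (derivWithin U I01) I01 ρ * K (K f) ρ / (ρ : ℂ) ^ 2)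
        (derivWithin U I01 ρ * K (K f) ρ / (ρ : ℂ) ^ 3)
      linarith
    have := norm_nonneg (D (D (potMap V hV u).fst) ρ)
    nlinarith [sq_nonneg (A * N - M0 * ‖f ρ‖)]
  have hsnd : ∀ ρ ∈ Ioc (0 : ℝ) 1, ‖derivWithin (potMap V hV u).snd I01 ρ‖ ^ 2 = 0 := by
    intro ρ hρ
    have hρ' := Ioc_subset_Icc_self hρ
    have e : EqOn (potMap V hV u).snd (fun _ => 0) I01 := ext_restrict (0 : ℝ → ℂ)
    rw [derivWithin_congr e (e hρ')]
    simp
  have i0 : IntervalIntegrable (fun ρ => ‖f ρ‖ ^ 2) volume 0 1 :=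
    intervalIntegrable_of_continuousOn_I01 (cf.norm.pow 2)
  have hmono : ∫ ρ in (0 : ℝ)..1, ‖D (D (potMap V hV u).fst) ρ‖ ^ 2
      ≤ ∫ ρ in (0 : ℝ)..1, 2 * (A ^ 2 * N ^ 2 + M0 ^ 2 * ‖f ρ‖ ^ 2) := by
    refine intervalIntegral.integral_mono_on_of_le_Ioo zero_le_one ?_ ?_
      fun ρ hρ => hb ρ (Ioo_subset_Ioc_self hρ)
    · have := ((potMap V hV u).DD_mul_integrable (potMap V hV u)).norm
      simpa only [norm_mul, RCLike.norm_conj, ← sq] using this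
    · exact (intervalIntegrable_const.add (i0.const_mul _)).const_mul _
  have hval : ∫ ρ in (0 : ℝ)..1, 2 * (A ^ 2 * N ^ 2 + M0 ^ 2 * ‖f ρ‖ ^ 2)
      = 2 * (A ^ 2 * N ^ 2 + M0 ^ 2 * ∫ ρ in (0 : ℝ)..1, ‖f ρ‖ ^ 2) := by
    rw [intervalIntegral.integral_const_mul, intervalIntegral.integral_add
      intervalIntegrable_const (i0.const_mul _), intervalIntegral.integral_const_mul (M0 ^ 2),
      intervalIntegral.integral_const, sub_zero, one_smul]
  have hJ : N ^ 2 ≤ ∫ ρ in (0 : ℝ)..1, ‖f ρ‖ ^ 2 := sq_integral_norm_le cf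
  rw [PreH.norm_sq_eq, integral_congr_Ioc hsnd, intervalIntegral.integral_zero, add_zero]
  refine hmono.trans (hval.trans_le ?_)
  nlinarith [sq_nonneg A]

/-- The gain of a factor `|z|`: by the second component of the equation `(z - L₀) u = f`,
`z u₂ = D² u₁ - ρ u₂' - u₂ + f₂`, so that `|z| ‖u₂‖` is bounded in `L²` by the norms of `u`
and `f`. -/
lemma norm_sq_mul_integral_snd_sq_le (z : ℂ) (u : smoothDomain) :
    ‖z‖ ^ 2 * ∫ ρ in (0 : ℝ)..1, ‖u.1.snd ρ‖ ^ 2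
      ≤ 8 * (‖u.1‖ + ‖z • u.1 - freeMap u‖) ^ 2 := by
  set f := z • u.1 - freeMap u with hf
  have hfs : ∀ ρ ∈ I01, z * u.1.snd ρ = D (D u.1.fst) ρ - (ρ : ℂ) * derivWithin u.1.snd I01 ρ
      - u.1.snd ρ + f.snd ρ := by
    intro ρ hρ
    have h : f.snd ρ = z * u.1.snd ρ - (freeMap u).snd ρ := rfl
    rw [h, freeMap_snd u hρ, freeSnd]
    ring
  have cv := (DD_contDiffOn u.2.1 u.2.2.2.1).continuousOn
  have i1 : IntervalIntegrable (fun ρ => ‖D (D u.1.fst) ρ‖ ^ 2) volume 0 1 :=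
    intervalIntegrable_of_continuousOn_I01 (cv.norm.pow 2)
  have i2 : IntervalIntegrable (fun ρ => ‖derivWithin u.1.snd I01 ρ‖ ^ 2) volume 0 1 :=
    intervalIntegrable_of_continuousOn_I01 (u.1.snd_deriv_continuousOn.norm.pow 2)
  have i3 : IntervalIntegrable (fun ρ => ‖u.1.snd ρ‖ ^ 2) volume 0 1 :=
    intervalIntegrable_of_continuousOn_I01 (u.1.snd_contDiffOn.continuousOn.norm.pow 2)
  have i4 : IntervalIntegrable (fun ρ => ‖f.snd ρ‖ ^ 2) volume 0 1 :=
    intervalIntegrable_of_continuousOn_I01 (f.snd_contDiffOn.continuousOn.norm.pow 2)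
  have hb : ∀ ρ ∈ I01, ‖z‖ ^ 2 * ‖u.1.snd ρ‖ ^ 2 ≤ 4 * (‖D (D u.1.fst) ρ‖ ^ 2
      + ‖derivWithin u.1.snd I01 ρ‖ ^ 2 + ‖u.1.snd ρ‖ ^ 2 + ‖f.snd ρ‖ ^ 2) := by
    intro ρ hρ
    have hw : ‖(ρ : ℂ) * derivWithin u.1.snd I01 ρ‖ ≤ ‖derivWithin u.1.snd I01 ρ‖ := by
      rw [norm_mul, Complex.norm_of_nonneg hρ.1]
      exact mul_le_of_le_one_left (norm_nonneg _) hρ.2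
    have h : ‖z * u.1.snd ρ‖ ≤ ‖D (D u.1.fst) ρ‖ + ‖derivWithin u.1.snd I01 ρ‖
        + ‖u.1.snd ρ‖ + ‖f.snd ρ‖ := by
      rw [hfs ρ hρ]
      refine (norm_add_le _ _).trans (add_le_add ?_ le_rfl)
      refine (norm_sub_le _ _).trans (add_le_add ?_ le_rfl)
      exact (norm_sub_le _ _).trans (add_le_add le_rfl hw)
    rw [← mul_pow, ← norm_mul]
    refine (pow_le_pow_left₀ (norm_nonneg _) h 2).trans ?_
    generalize ‖D (D u.1.fst) ρ‖ = a
    generalize ‖derivWithin u.1.snd I01 ρ‖ = b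
    generalize ‖u.1.snd ρ‖ = c
    generalize ‖f.snd ρ‖ = d
    nlinarith [sq_nonneg (a - b), sq_nonneg (a - c), sq_nonneg (a - d), sq_nonneg (b - c),
      sq_nonneg (b - d), sq_nonneg (c - d)]
  have hmono := intervalIntegral.integral_mono_on zero_le_one (i3.const_mul (‖z‖ ^ 2))
    ((((i1.add i2).add i3).add i4).const_mul 4) hb
  rw [intervalIntegral.integral_const_mul, intervalIntegral.integral_const_mul,
    intervalIntegral.integral_add ((i1.add i2).add i3) i4,
    intervalIntegral.integral_add (i1.add i2) i3, intervalIntegral.integral_add i1 i2,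
    ← PreH.norm_sq_eq] at hmono
  have h3 := u.1.integral_snd_sq_le
  have h4 := f.integral_snd_sq_le
  nlinarith [mul_nonneg (norm_nonneg u.1) (norm_nonneg f), sq_nonneg ‖f‖]

/-! ### The resolvent of the linearized generator -/

lemma embDomain_mem (u : smoothDomain) : embDomain u ∈ L0tilde.domain :=
  LinearMap.mem_range_self embDomain u

lemma L0tilde_apply (u : smoothDomain) (h : embDomain u ∈ L0tilde.domain) :
    L0tilde ⟨embDomain u, h⟩ = emb (freeMap u) := by
  change emb (freeMap ((LinearEquiv.ofInjective embDomain embDomain_injective).symm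
    ⟨embDomain u, h⟩)) = _
  congr 2
  rw [LinearEquiv.symm_apply_eq]
  rfl

lemma L0tilde_forall {P : L0tilde.domain → Prop}
    (h : ∀ u : smoothDomain, P ⟨embDomain u, embDomain_mem u⟩) : ∀ x, P x := by
  rintro ⟨_, u, rfl⟩
  exact h u

lemma L0tilde_dissipative (x : L0tilde.domain) :
    (inner ℂ (x : H) (L0tilde x)).re ≤ -(3 / 2) * ‖(x : H)‖ ^ 2 := by
  revert x
  refine L0tilde_forall fun u => ?_
  rw [L0tilde_apply]
  change (inner ℂ ((u.1 : PreH) : H) ((freeMap u : PreH) : H)).re ≤ -(3 / 2) * ‖((u.1 : PreH) : H)‖ ^ 2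
  rw [UniformSpace.Completion.inner_coe, UniformSpace.Completion.norm_coe]
  exact freeMap_dissipative u

lemma L0tilde_dense : Dense (L0tilde.domain : Set H) := denseRange_embDomain

lemma L0tilde_sub_apply (z : ℂ) (u : smoothDomain) (h : embDomain u ∈ L0tilde.domain) :
    z • embDomain u - L0tilde ⟨embDomain u, h⟩ = emb (z • u.1 - freeMap u) := by
  rw [L0tilde_apply, map_sub, map_smul]
  rfl

lemma L0tilde_denseRange {z : ℂ} (hz : -2 < z.re) :
    DenseRange fun x : L0tilde.domain => z • (x : H) - L0tilde x := by
  refine (denseRange_sub_freeMap hz).mono ?_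
  rintro _ ⟨u, rfl⟩
  exact ⟨⟨embDomain u, embDomain_mem u⟩, L0tilde_sub_apply z u _⟩

lemma Lprime_embDomain (V : ℝ → ℝ) (hV : ContDiffOn ℝ ∞ V I01) (u : smoothDomain) :
    Lprime V hV (embDomain u) = emb (potMap V hV u) := by
  obtain ⟨M, hM0, hM⟩ := exists_norm_potMap_le V hV
  refine LinearMap.extendOfNorm_eq denseRange_embDomain ⟨√M, fun u => ?_⟩ u
  change ‖emb (potMap V hV u)‖ ≤ √M * ‖emb u.1‖
  rw [norm_emb, norm_emb]
  refine le_of_sq_le_sq ?_ (by positivity)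
  rw [mul_pow, Real.sq_sqrt hM0]
  exact (hM u).trans (mul_le_mul_of_nonneg_left u.1.integral_snd_sq_le hM0)

/-- On the domain of `L̃₀` the potential term is bounded relative to `z - L̃₀` with a relative
bound `O(|z|⁻¹)`, uniformly in the half-plane `Re z ≥ -3/2 + ε`. -/
lemma exists_norm_Lprime_le (V : ℝ → ℝ) (hV : ContDiffOn ℝ ∞ V I01) {ε : ℝ} (hε : 0 < ε) :
    ∃ c : ℝ, 0 ≤ c ∧ ∀ z : ℂ, -3 / 2 + ε ≤ z.re → ∀ x : L0tilde.domain,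
      ‖z‖ * ‖Lprime V hV x‖ ≤ c * ‖z • (x : H) - L0tilde x‖ := by
  obtain ⟨M, hM0, hM⟩ := exists_norm_potMap_le V hV
  refine ⟨√(8 * M) * (ε⁻¹ + 1), by positivity, fun z hz => L0tilde_forall fun u => ?_⟩
  have hlow := lower_bound_of_dissipative L0tilde_dissipative z
    ⟨embDomain u, embDomain_mem u⟩
  simp only [L0tilde_sub_apply, Lprime_embDomain] at hlow ⊢
  change _ * ‖emb u.1‖ ≤ _ at hlow
  rw [norm_emb, norm_emb] at hlow
  rw [norm_emb, norm_emb]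
  set s := ‖z • u.1 - freeMap u‖
  have h1 : ‖u.1‖ ≤ ε⁻¹ * s := by
    rw [inv_mul_eq_div, le_div_iff₀ hε, mul_comm]
    refine le_trans (mul_le_mul_of_nonneg_right ?_ (norm_nonneg _)) hlow
    linarith
  have h2 : ‖z‖ * ‖potMap V hV u‖ ≤ √(8 * M) * (‖u.1‖ + s) := by
    refine le_of_sq_le_sq ?_ (by positivity)
    rw [mul_pow, mul_pow, Real.sq_sqrt (by positivity)]
    calc ‖z‖ ^ 2 * ‖potMap V hV u‖ ^ 2
        ≤ ‖z‖ ^ 2 * (M * ∫ ρ in (0 : ℝ)..1, ‖u.1.snd ρ‖ ^ 2) :=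
          mul_le_mul_of_nonneg_left (hM u) (by positivity)
      _ = M * (‖z‖ ^ 2 * ∫ ρ in (0 : ℝ)..1, ‖u.1.snd ρ‖ ^ 2) := by ring
      _ ≤ M * (8 * (‖u.1‖ + s) ^ 2) :=
          mul_le_mul_of_nonneg_left (norm_sq_mul_integral_snd_sq_le z u) hM0
      _ = 8 * M * (‖u.1‖ + s) ^ 2 := by ring
  calc _ ≤ √(8 * M) * (‖u.1‖ + s) := h2
    _ ≤ √(8 * M) * (ε⁻¹ * s + s) := by gcongr
    _ = _ := by ring

lemma exists_resolvent_L (V : ℝ → ℝ) (hV : ContDiffOn ℝ ∞ V I01) {ε : ℝ} (hε : 0 < ε) :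
    ∃ C₁ C₂ : ℝ, 0 < C₁ ∧ 0 < C₂ ∧ ∀ z : ℂ, -3 / 2 + ε ≤ z.re → C₁ ≤ ‖z‖ →
      ∃ R : H →L[ℂ] H, IsResolvent (L V hV) z R ∧ ‖R‖ ≤ C₂ := by
  obtain ⟨c, hc0, hc⟩ := exists_norm_Lprime_le V hV hε
  refine ⟨2 * c + 1, 2 * ε⁻¹, by positivity, by positivity, fun z hz hzC => ?_⟩
  have hpos : ε ≤ z.re + 3 / 2 := by linarith
  obtain ⟨R, hR, hRn, hRB⟩ := exists_resolvent_closure L0tilde_dissipative L0tilde_dense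
    (hε.trans_le hpos) (L0tilde_denseRange (by linarith : -2 < z.re))
  have hB : ‖(Lprime V hV).comp R‖ ≤ 1 / 2 := by
    refine hRB _ _ (by norm_num) fun x => ?_
    have hzpos : 0 < ‖z‖ := by linarith
    refine le_of_mul_le_mul_left ((hc z hz x).trans ?_) hzpos
    rw [← mul_assoc]
    exact mul_le_mul_of_nonneg_right (by linarith) (norm_nonneg _)
  obtain ⟨R', hR', hn⟩ := exists_resolvent_vadd (A := L0) hR (Lprime V hV) hB
  refine ⟨R', hR', hn.trans ?_⟩
  have : ‖R‖ ≤ ε⁻¹ := hRn.trans (inv_anti₀ hε hpos)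
  linarith

lemma exists_no_eigenvalue_L (V : ℝ → ℝ) (hV : ContDiffOn ℝ ∞ V I01) :
    ∃ C : ℝ, 0 < C ∧ ∀ z : ℂ, 0 ≤ z.re → C ≤ |z.im| → ¬ IsEigenvalue (L V hV) z := by
  obtain ⟨C₁, C₂, h1, -, h⟩ := exists_resolvent_L V hV (ε := 3 / 2) (by norm_num)
  refine ⟨C₁, h1, fun z hz hC => ?_⟩
  obtain ⟨R, hR, -⟩ := h z (by linarith) (hC.trans (Complex.abs_im_le_norm z))
  exact hR.not_isEigenvalue

end YangMills

/-- First part: the generator `L` with the Yang–Mills potential. Second part: the same for the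
generator with an arbitrary smooth potential. -/
theorem lemma3p9 :
    ((∀ ε : ℝ, 0 < ε → ∃ C₁ C₂ : ℝ, 0 < C₁ ∧ 0 < C₂ ∧
        ∀ z : ℂ, -3 / 2 + ε ≤ z.re → C₁ ≤ ‖z‖ →
          ∃ R : YangMills.H →L[ℂ] YangMills.H,
            YangMills.IsResolvent
              (YangMills.L YangMills.ymPotential YangMills.ymPotential_contDiffOn) z R ∧
            ‖R‖ ≤ C₂) ∧
      ∃ C : ℝ, 0 < C ∧ ∀ z : ℂ, 0 ≤ z.re → C ≤ |z.im| →
        ¬ YangMills.IsEigenvalue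
          (YangMills.L YangMills.ymPotential YangMills.ymPotential_contDiffOn) z) ∧
    ∀ (V : ℝ → ℝ) (hV : ContDiffOn ℝ ∞ V (Set.Icc 0 1)),
      (∀ ε : ℝ, 0 < ε → ∃ C₁ C₂ : ℝ, 0 < C₁ ∧ 0 < C₂ ∧
        ∀ z : ℂ, -3 / 2 + ε ≤ z.re → C₁ ≤ ‖z‖ →
          ∃ R : YangMills.H →L[ℂ] YangMills.H,
            YangMills.IsResolvent (YangMills.L V hV) z R ∧ ‖R‖ ≤ C₂) ∧
      ∃ C : ℝ, 0 < C ∧ ∀ z : ℂ, 0 ≤ z.re → C ≤ |z.im| →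
        ¬ YangMills.IsEigenvalue (YangMills.L V hV) z := by
  exact ⟨⟨fun _ => YangMills.exists_resolvent_L _ _, YangMills.exists_no_eigenvalue_L _ _⟩,
    fun V hV => ⟨fun _ => YangMills.exists_resolvent_L V hV, YangMills.exists_no_eigenvalue_L V hV⟩⟩
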